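/- Let $n_r\ge n_t\ge 2$ and $\delta>0$. Let ${\bf H}$ be a random complex $n_r\times n_t$ matrix such that ${\bf H}^\dagger{\bf H}$ has the same distribution as ${\bf U}^\dagger\boldsymbol{\Lambda}{\bf U}$, where ${\bf U}$ is Haar-distributed on the unitary group $\mathcal U(n_t)$ and is independent of $\boldsymbol\Lambda=\mathrm{diag}(\lambda_1,\dots,\lambda_{n_t})$, whose entries are positive with joint density on $(0,\infty)^{n_t}$ $$p(\boldsymbol\Lambda)=\frac1{n_t!}\prod_{k>\ell}(\lambda_k-\lambda_\ell)\,\det[q_{b-1}(\lambda_a)]_{a,b=1,\dots,n_t}$$ for real functions $q_0,\dots,q_{n_t-1}$ on $(0,\infty)$. Let $p_0,\dots,p_{n_t-1}$ be monic real polynomials with $\deg p_j=j$ and $\int_0^\infty p_a(\lambda)q_b(\lambda)\,d\lambda=\delta_{ab}$ (Kronecker delta), where these integrals converge absolutely, and put $K(x,y)=\sum_{j=0}^{n_t-1}p_j(x)q_j(y)$. (That is, ${\bf H}$ is an invariant polynomial ensemble without transmit correlation, with kernel $K$; Pólya ensembles are a special case.) For $k=1,\dots,n_t$ let $$\gamma_k=\frac1{[({\bf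 I}+\delta{\bf H}^\dagger{\bf H})^{-1}]_{k,k}}-1$$ be the output SINR of the $k$-th stream at the MMSE receiver. Then each $\gamma_k$ has on $(0,\infty)$ the probability density $$\rho(\gamma)=\frac{n_t-1}{\delta}\left(\frac{\gamma}{\gamma+1}\right)^{n_t}\int_0^1(1-x)^{n_t-2}\left(x+\frac1\gamma\right)K\!\left(-\frac1\delta,\frac{\gamma x}{\delta}\right)dx ,$$ and the ergodic sum rate $R=\sum_{k=1}^{n_t}\mathbb E[\ln(1+\gamma_k)]$ is $$R=n_t\left[\int_0^\infty\ln(1+\delta x)\,K\!\left(-\frac1\delta,x\right)dx+\gamma_E+\Psi(n_t)\right],$$ where $\gamma_E$ is Euler's constant and $\Psi=\Gamma'/\Gamma$ is the digamma function. All expectations and integrals here converge absolutely. -/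

import Mathlib

open MeasureTheory
open scoped Matrix

/-! ### Complex matrices and the unitary group as measurable spaces -/

/-- The entrywise (equivalently, Borel) σ-algebra on complex matrices. -/
noncomputable instance Matrix.complexMeasurableSpace (m n : Type) : MeasurableSpace (Matrix m n ℂ) :=
  inferInstanceAs (MeasurableSpace (m → n → ℂ))

instance Matrix.complexBorelSpace (m n : Type) [Fintype m] [Fintype n] :
    BorelSpace (Matrix m n ℂ) :=
  inferInstanceAs (BorelSpace (m → n → ℂ))

noncomputable instance Matrix.unitaryGroupMeasurableSpace (n : ℕ) :
    MeasurableSpace (Matrix.unitaryGroup (Fin n) ℂ) :=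
  Subtype.instMeasurableSpace

instance Matrix.unitaryGroupBorelSpace (n : ℕ) :
    BorelSpace (Matrix.unitaryGroup (Fin n) ℂ) :=
  Subtype.borelSpace _

instance Matrix.unitaryGroupCompactSpace (n : ℕ) :
    CompactSpace (Matrix.unitaryGroup (Fin n) ℂ) := by
  have hc : IsClosed {A : Matrix (Fin n) (Fin n) ℂ | A ∈ Matrix.unitaryGroup (Fin n) ℂ} := by
    have h : {A : Matrix (Fin n) (Fin n) ℂ | A ∈ Matrix.unitaryGroup (Fin n) ℂ}
        = (fun A : Matrix (Fin n) (Fin n) ℂ => A * star A) ⁻¹' {1} := by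
      ext A
      simp [Matrix.mem_unitaryGroup_iff]
    rw [h]
    exact isClosed_singleton.preimage (continuous_id.mul continuous_star)
  have hK : IsCompact (Set.pi Set.univ fun _ : Fin n => Set.pi Set.univ fun _ : Fin n =>
      Metric.closedBall (0 : ℂ) 1) :=
    isCompact_univ_pi fun _ => isCompact_univ_pi fun _ => isCompact_closedBall 0 1
  refine isCompact_iff_compactSpace.mp (hK.of_isClosed_subset hc ?_)
  intro A hA i _ j _
  simpa using entry_norm_bound_of_unitary hA i j

/-- The Haar probability measure on the unitary group `U(n)` (the Haar measure normalised to give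
the whole compact group mass one). -/
noncomputable def unitaryHaar (n : ℕ) : Measure (Matrix.unitaryGroup (Fin n) ℂ) :=
  Measure.haarMeasure ⊤

/-! ### Invariant polynomial ensembles -/

/-- `p 0, …, p (n-1)` are monic real polynomials with `deg p_j = j` that are biorthonormal on
`(0, ∞)` to the weight functions `q 0, …, q (n-1)`, all the integrals being absolutely
convergent. -/
structure IsBiorthonormalSystem {n : ℕ} (p : Fin n → Polynomial ℝ) (q : Fin n → ℝ → ℝ) :
    Prop where
  monic : ∀ a, (p a).Monic
  natDegree_eq : ∀ a, (p a).natDegree = (a : ℕ)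
  integrable : ∀ a b, IntegrableOn (fun x => (p a).eval x * q b x) (Set.Ioi 0)
  biorthonormal : ∀ a b, ∫ x in Set.Ioi (0 : ℝ), (p a).eval x * q b x = if a = b then 1 else 0

/-- The joint eigenvalue density `(1/n!) Δ(Λ) det[q_{b-1}(λ_a)]` of a polynomial ensemble, with
`Δ(Λ) = ∏_{k > ℓ} (λ_k - λ_ℓ)`. -/
noncomputable def polynomialEnsembleDensity {n : ℕ} (q : Fin n → ℝ → ℝ) (l : Fin n → ℝ) : ℝ :=
  1 / (n.factorial : ℝ) * (∏ k : Fin n, ∏ j ∈ Finset.Iio k, (l k - l j)) *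
    (Matrix.of fun a b : Fin n => q b (l a)).det

/-- The kernel `K(x, y) = ∑_j p_j(x) q_j(y)`. -/
noncomputable def polynomialEnsembleKernel {n : ℕ} (p : Fin n → Polynomial ℝ)
    (q : Fin n → ℝ → ℝ) (x y : ℝ) : ℝ :=
  ∑ j : Fin n, (p j).eval x * q j y

/-- The random `nr × nt` matrix `H` is an invariant polynomial ensemble with weight functions `q`
and associated monic polynomials `p`: the random matrix `Hᴴ H` is distributed as `Uᴴ Λ U`, where
`U` is Haar-distributed on `U(nt)` and independent of the diagonal matrix `Λ`, whose entries are
positive and have the joint density `polynomialEnsembleDensity q`. -/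
structure IsInvariantPolynomialEnsemble {Ω : Type*} [MeasurableSpace Ω] (P : Measure Ω)
    {nr nt : ℕ} (H : Ω → Matrix (Fin nr) (Fin nt) ℂ)
    (p : Fin nt → Polynomial ℝ) (q : Fin nt → ℝ → ℝ) : Prop where
  aemeasurable : AEMeasurable H P
  system : IsBiorthonormalSystem p q
  density_nonneg : ∀ᵐ l ∂(volume.restrict (Set.univ.pi fun _ : Fin nt => Set.Ioi (0 : ℝ))),
    0 ≤ polynomialEnsembleDensity q l
  map_gram : P.map (fun ω => (H ω)ᴴ * H ω) =
    ((unitaryHaar nt).prod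
      ((volume.restrict (Set.univ.pi fun _ : Fin nt => Set.Ioi (0 : ℝ))).withDensity
        fun l => ENNReal.ofReal (polynomialEnsembleDensity q l))).map
      fun Ul : Matrix.unitaryGroup (Fin nt) ℂ × (Fin nt → ℝ) =>
        ((Ul.1 : Matrix (Fin nt) (Fin nt) ℂ))ᴴ * Matrix.diagonal (fun a => (Ul.2 a : ℂ)) *
          (Ul.1 : Matrix (Fin nt) (Fin nt) ℂ)

/-! ### The MMSE receiver -/

/-- The output SINR `1 / [(I + δ Hᴴ H)⁻¹]_{k,k} - 1` of the `k`-th stream at the MMSE receiver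
(the diagonal entries of the Hermitian matrix `(I + δ Hᴴ H)⁻¹` are real). -/
noncomputable def mmseSINR {nr nt : ℕ} (δ : ℝ) (H : Matrix (Fin nr) (Fin nt) ℂ) (k : Fin nt) : ℝ :=
  1 / ((1 + (δ : ℂ) • (Hᴴ * H) : Matrix (Fin nt) (Fin nt) ℂ)⁻¹ k k).re - 1

/-- The ergodic sum rate `∑_k 𝔼[ln(1 + γ_k)]` of the MMSE receiver, in nats. -/
noncomputable def mmseSumRate {Ω : Type*} [MeasurableSpace Ω] (P : Measure Ω) {nr nt : ℕ} (δ : ℝ)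
    (H : Ω → Matrix (Fin nr) (Fin nt) ℂ) : ℝ :=
  ∑ k : Fin nt, ∫ ω, Real.log (1 + mmseSINR δ (H ω) k) ∂P

/-!
Write `t = (1 + γ)⁻¹ = [(1 + δ Hᴴ H)⁻¹]ₖₖ`, so that `t = ∑ₐ |Uₐₖ|² / (1 + δ λₐ)`. The law of `γ` is
identified through the transform `s ↦ 𝔼[(1 + s t)⁻ⁿ]`, whose Taylor coefficients at `0` are nonzero
multiples of the moments of the bounded variable `t`. The exponent `n` makes the transform
computable: integrating a Gaussian vector in polar coordinates shows that the Haar average of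
`(∑ₐ Dₐ |Uₐₖ|²)⁻ⁿ` is `∏ₐ Dₐ⁻¹`. With `u = -1 / δ` and `v = -(1 + s) / δ` the transform is therefore
`𝔼 ∏ₐ (u - λₐ) / (v - λₐ)`, which Lagrange interpolation and the Andréief identity turn into
`∫ K(u, y) (u - y) / (v - y) dy`. On the other side `ρ` is the mixture, with signed weight
`K(-1 / δ, y) dy`, of the laws of `(1 + δ y) / T - 1` with `T` distributed as `Beta(1, n - 1)`, for
which the transform and the mean of `log (1 + γ)` are elementary.
-/

open Filter Topology Set ProbabilityTheory

/-! ### Measures determined by moments and by Stieltjes transforms -/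

lemma measure_eq_of_forall_integral_pow_eq {μ ν : Measure ℝ} [IsFiniteMeasure μ]
    [IsFiniteMeasure ν] (hμ : 0 ∈ interior (integrableExpSet id μ))
    (hν : 0 ∈ interior (integrableExpSet id ν))
    (h : ∀ m : ℕ, ∫ x, x ^ m ∂μ = ∫ x, x ^ m ∂ν) : μ = ν := by
  have power_series (κ : Measure ℝ) (hκ : 0 ∈ interior (integrableExpSet id κ)) :
      HasFPowerSeriesAt (complexMGF id κ)
        (FormalMultilinearSeries.ofScalars ℂ fun m => ((∫ x, x ^ m ∂κ : ℝ) : ℂ) / m.factorial)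
        0 := by
    convert! (analyticAt_complexMGF (z := 0) hκ).hasFPowerSeriesAt with
    rw [iteratedDeriv_complexMGF (by simpa using hκ), ← integral_complex_ofReal]
    simp
  have eq_near_zero : complexMGF id μ =ᶠ[𝓝 0] complexMGF id ν := by
    have hμ' := power_series μ hμ
    simp only [h] at hμ'
    filter_upwards [hμ'.eventually_hasSum_sub, (power_series ν hν).eventually_hasSum_sub]
      with z h1 h2 using h1.unique h2
  set S : Set ℂ := {z | z.re ∈ interior (integrableExpSet id μ) ∩ interior (integrableExpSet id ν)}
  have isPreconnected_strip : IsPreconnected S :=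
    ((convex_integrableExpSet.interior.inter convex_integrableExpSet.interior).linear_preimage
      Complex.reLm).isPreconnected
  have eq_on_strip : EqOn (complexMGF id μ) (complexMGF id ν) S :=
    (analyticOnNhd_complexMGF.mono fun z hz => hz.1).eqOn_of_preconnected_of_eventuallyEq
      (analyticOnNhd_complexMGF.mono fun z hz => hz.2) isPreconnected_strip ⟨hμ, hν⟩ eq_near_zero
  refine Measure.ext_of_charFun (funext fun t => ?_)
  rw [← complexMGF_id_mul_I, ← complexMGF_id_mul_I]
  exact eq_on_strip (by simpa [S] using ⟨hμ, hν⟩)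

lemma integrableExpSet_id_eq_univ_of_ae_abs_le {μ : Measure ℝ} [IsFiniteMeasure μ] {C : ℝ}
    (hμ : ∀ᵐ x ∂μ, |x| ≤ C) : integrableExpSet id μ = univ :=
  eq_univ_of_forall fun _ =>
    integrable_exp_mul_of_mem_Icc (a := -C) (b := C) aemeasurable_id
      (hμ.mono fun _ hx => abs_le.1 hx)

lemma half_lt_one_add_mul {C s x : ℝ} (hx : |x| ≤ C) (hs : |s| * C < 1 / 2) :
    1 / 2 < 1 + s * x := by
  have h : |s * x| < 1 / 2 := by
    rw [abs_mul]
    exact (mul_le_mul_of_nonneg_left hx (abs_nonneg s)).trans_lt hs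
  linarith [neg_abs_le (s * x)]

lemma norm_pow_div_one_add_mul_pow_le {C s x : ℝ} (hx : |x| ≤ C) (hs : |s| * C < 1 / 2)
    (i j : ℕ) : ‖x ^ i / (1 + s * x) ^ j‖ ≤ C ^ i * 2 ^ j := by
  have h1 := half_lt_one_add_mul hx hs
  have h2 : (1 + s * x)⁻¹ ≤ 2 := by
    rw [inv_le_comm₀ (by linarith) two_pos]
    linarith
  have h3 : 0 ≤ (1 + s * x)⁻¹ := inv_nonneg.2 (by linarith)
  rw [div_eq_mul_inv, ← inv_pow, norm_mul, norm_pow, norm_pow, Real.norm_of_nonneg h3]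
  have hC : 0 ≤ C := (abs_nonneg x).trans hx
  have : ‖x‖ ≤ C := hx
  gcongr

lemma hasDerivAt_pow_div_one_add_mul_pow (n m : ℕ) {s x : ℝ} (hs : 1 + s * x ≠ 0) :
    HasDerivAt (fun s => x ^ m / (1 + s * x) ^ (n + m))
      (-((n + m : ℕ) : ℝ) * (x ^ (m + 1) / (1 + s * x) ^ (n + (m + 1)))) s := by
  have hl : HasDerivAt (fun s : ℝ => 1 + s * x) x s := by
    simpa using ((hasDerivAt_id s).mul_const x).const_add 1
  refine ((hasDerivAt_const s (x ^ m)).div (hl.pow (n + m)) (pow_ne_zero _ hs)).congr_deriv ?_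
  simp only [Pi.pow_apply]
  rcases Nat.eq_zero_or_pos (n + m) with h0 | h0
  · simp [h0]
  · obtain ⟨k, hk⟩ := Nat.exists_eq_add_of_le' h0
    rw [show n + (m + 1) = k + 2 by omega, hk, show k + 1 - 1 = k from rfl]
    field_simp
    ring

lemma hasDerivAt_integral_pow_div_one_add_mul_pow {μ : Measure ℝ} [IsFiniteMeasure μ] {C : ℝ}
    (hμ : ∀ᵐ x ∂μ, |x| ≤ C) (n m : ℕ) {s : ℝ} (hs : |s| * C < 1 / 2) :
    HasDerivAt (fun s => ∫ x, x ^ m / (1 + s * x) ^ (n + m) ∂μ)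
      (-((n + m : ℕ) : ℝ) * ∫ x, x ^ (m + 1) / (1 + s * x) ^ (n + (m + 1)) ∂μ) s := by
  have hS : {t : ℝ | |t| * C < 1 / 2} ∈ 𝓝 s :=
    (isOpen_lt (by fun_prop) continuous_const).mem_nhds hs
  have hmeas (t : ℝ) (i j : ℕ) : AEStronglyMeasurable (fun x : ℝ => x ^ i / (1 + t * x) ^ j) μ :=
    Measurable.aestronglyMeasurable (by fun_prop)
  rw [← integral_const_mul]
  refine (hasDerivAt_integral_of_dominated_loc_of_deriv_le hS
    (F' := fun t x => -((n + m : ℕ) : ℝ) * (x ^ (m + 1) / (1 + t * x) ^ (n + (m + 1))))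
    (bound := fun _ => ((n + m : ℕ) : ℝ) * (C ^ (m + 1) * 2 ^ (n + (m + 1))))
    (Eventually.of_forall fun t => hmeas t _ _)
    (Integrable.of_bound (hmeas s _ _) (C ^ m * 2 ^ (n + m)) ?_)
    ((hmeas s _ _).const_mul _) ?_ (integrable_const _) ?_).2
  · filter_upwards [hμ] with x hx using norm_pow_div_one_add_mul_pow_le hx hs _ _
  · filter_upwards [hμ] with x hx t ht
    rw [norm_mul, norm_neg, Real.norm_of_nonneg (by positivity)]
    exact mul_le_mul_of_nonneg_left (norm_pow_div_one_add_mul_pow_le hx ht _ _) (by positivity)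
  · filter_upwards [hμ] with x hx t ht
    exact hasDerivAt_pow_div_one_add_mul_pow n m
      (one_half_pos.trans (half_lt_one_add_mul hx ht)).ne'

lemma measure_eq_of_eventually_integral_inv_one_add_mul_pow_eq {μ ν : Measure ℝ}
    [IsFiniteMeasure μ] [IsFiniteMeasure ν] {C : ℝ} (hμ : ∀ᵐ x ∂μ, |x| ≤ C)
    (hν : ∀ᵐ x ∂ν, |x| ≤ C) {n : ℕ} (hn : n ≠ 0)
    (h : ∀ᶠ s in 𝓝 (0 : ℝ), ∫ x, ((1 + s * x) ^ n)⁻¹ ∂μ = ∫ x, ((1 + s * x) ^ n)⁻¹ ∂ν) :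
    μ = ν := by
  have hS : ∀ᶠ s in 𝓝 (0 : ℝ), |s| * C < 1 / 2 :=
    (isOpen_lt (by fun_prop) continuous_const).mem_nhds (by simp)
  have transforms_eq (m : ℕ) : ∀ᶠ s in 𝓝 (0 : ℝ),
      ∫ x, x ^ m / (1 + s * x) ^ (n + m) ∂μ = ∫ x, x ^ m / (1 + s * x) ^ (n + m) ∂ν := by
    induction m with
    | zero => simpa using h
    | succ m ih =>
      filter_upwards [ih.eventually_nhds, hS] with s hs hsC
      have hderiv := (hasDerivAt_integral_pow_div_one_add_mul_pow hμ n m hsC).unique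
        ((hasDerivAt_integral_pow_div_one_add_mul_pow hν n m hsC).congr_of_eventuallyEq hs)
      exact mul_left_cancel₀ (neg_ne_zero.2 (Nat.cast_ne_zero.2 (by omega))) hderiv
  refine measure_eq_of_forall_integral_pow_eq ?_ ?_ fun m => ?_
  · simp [integrableExpSet_id_eq_univ_of_ae_abs_le hμ]
  · simp [integrableExpSet_id_eq_univ_of_ae_abs_le hν]
  · simpa using (transforms_eq m).self_of_nhds

lemma abs_inv_one_add_le_one {g : ℝ} (hg : 0 < g) : |(1 + g)⁻¹| ≤ 1 := by
  rw [abs_of_nonneg (by positivity)]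
  exact inv_le_one_of_one_le₀ (by linarith)

lemma measure_eq_of_eventually_integral_inv_one_add_mul_inv_pow_eq {μ ν : Measure ℝ}
    [IsFiniteMeasure μ] [IsFiniteMeasure ν] (hμ : ∀ᵐ g ∂μ, 0 < g) (hν : ∀ᵐ g ∂ν, 0 < g)
    {n : ℕ} (hn : n ≠ 0)
    (h : ∀ᶠ s in 𝓝 (0 : ℝ), ∫ g, ((1 + s * (1 + g)⁻¹) ^ n)⁻¹ ∂μ =
      ∫ g, ((1 + s * (1 + g)⁻¹) ^ n)⁻¹ ∂ν) :
    μ = ν := by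
  let e : ℝ ≃ᵐ ℝ := (MeasurableEquiv.addLeft 1).trans (MeasurableEquiv.inv ℝ)
  have abs_le_one (κ : Measure ℝ) (hκ : ∀ᵐ g ∂κ, 0 < g) : ∀ᵐ x ∂κ.map e, |x| ≤ 1 := by
    rw [ae_map_iff e.measurable.aemeasurable (measurableSet_le (by fun_prop) measurable_const)]
    filter_upwards [hκ] with g hg using abs_inv_one_add_le_one hg
  refine e.map_measurableEquiv_injective ?_
  refine measure_eq_of_eventually_integral_inv_one_add_mul_pow_eq (abs_le_one μ hμ)
    (abs_le_one ν hν) hn ?_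
  simp only [integral_map_equiv]
  exact h

lemma ae_nonneg_of_withDensity_ofReal_neg_le {α : Type*} [MeasurableSpace α] {μ : Measure α}
    [SigmaFinite μ] {ρ : α → ℝ} (hρ : AEMeasurable ρ μ)
    (h : μ.withDensity (fun x => ENNReal.ofReal (-ρ x)) ≤
      μ.withDensity fun x => ENNReal.ofReal (ρ x)) :
    ∀ᵐ x ∂μ, 0 ≤ ρ x := by
  have hle : (fun x => ENNReal.ofReal (-ρ x)) ≤ᵐ[μ] fun x => ENNReal.ofReal (ρ x) :=
    ae_le_of_forall_setLIntegral_le_of_sigmaFinite₀ hρ.neg.ennreal_ofReal fun t ht _ => by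
      simpa only [withDensity_apply _ ht] using h t
  filter_upwards [hle] with x hx
  by_contra! hneg
  rw [ENNReal.ofReal_of_nonpos hneg.le, nonpos_iff_eq_zero, ENNReal.ofReal_eq_zero] at hx
  linarith

lemma withDensity_ofReal_neg_eq_zero {α : Type*} [MeasurableSpace α] {μ : Measure α} {ρ : α → ℝ}
    (hρ : ∀ᵐ x ∂μ, 0 ≤ ρ x) : μ.withDensity (fun x => ENNReal.ofReal (-ρ x)) = 0 := by
  rw [← withDensity_zero]
  exact withDensity_congr_ae (hρ.mono fun x hx => ENNReal.ofReal_of_nonpos (neg_nonpos.2 hx))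

lemma integrable_withDensity_ofReal {α : Type*} [MeasurableSpace α] {μ : Measure α} {ρ f : α → ℝ}
    (hρ : AEMeasurable ρ μ) (hf : Measurable f) (hfρ : Integrable (fun x => f x * ρ x) μ) :
    Integrable f (μ.withDensity fun x => ENNReal.ofReal (ρ x)) := by
  rw [integrable_withDensity_iff_integrable_smul₀' hρ.ennreal_ofReal
    (ae_of_all _ fun _ => ENNReal.ofReal_lt_top)]
  refine hfρ.mono (hρ.ennreal_ofReal.ennreal_toReal.mul hf.aemeasurable).aestronglyMeasurable
    (ae_of_all _ fun x => ?_)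
  rw [smul_eq_mul, ENNReal.toReal_ofReal', mul_comm, norm_mul, norm_mul]
  gcongr
  rw [Real.norm_of_nonneg (le_max_right _ _)]
  exact max_le (le_abs_self _) (abs_nonneg _)

lemma integral_withDensity_ofReal {α : Type*} [MeasurableSpace α] {μ : Measure α} {ρ : α → ℝ}
    (hρ : AEMeasurable ρ μ) (hρ0 : ∀ᵐ x ∂μ, 0 ≤ ρ x) (f : α → ℝ) :
    ∫ x, f x ∂μ.withDensity (fun x => ENNReal.ofReal (ρ x)) = ∫ x, ρ x * f x ∂μ := by
  rw [integral_withDensity_eq_integral_toReal_smul₀ hρ.ennreal_ofReal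
    (ae_of_all _ fun _ => ENNReal.ofReal_lt_top)]
  exact integral_congr_ae (hρ0.mono fun x hx => by
    simp only [ENNReal.toReal_ofReal hx, smul_eq_mul])

lemma integral_withDensity_ofReal_sub_integral_withDensity_ofReal_neg {α : Type*}
    [MeasurableSpace α] {μ : Measure α} {ρ f : α → ℝ} (hρ : AEMeasurable ρ μ) (hf : Measurable f)
    (hfρ : Integrable (fun x => f x * ρ x) μ) :
    ∫ x, f x ∂μ.withDensity (fun x => ENNReal.ofReal (ρ x)) -
      ∫ x, f x ∂μ.withDensity (fun x => ENNReal.ofReal (-ρ x)) = ∫ x, f x * ρ x ∂μ := by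
  have hfρ' : Integrable (fun x => f x * -ρ x) μ :=
    hfρ.neg.congr (ae_of_all _ fun x => (mul_neg _ _).symm)
  have hpos := integrable_withDensity_ofReal hρ hf hfρ
  have hneg := integrable_withDensity_ofReal hρ.neg hf hfρ'
  simp only [Pi.neg_apply] at hneg
  rw [integrable_withDensity_iff_integrable_smul₀' (by fun_prop)
    (ae_of_all _ fun _ => ENNReal.ofReal_lt_top)] at hpos hneg
  rw [integral_withDensity_eq_integral_toReal_smul₀ (by fun_prop)
      (ae_of_all _ fun _ => ENNReal.ofReal_lt_top),
    integral_withDensity_eq_integral_toReal_smul₀ (by fun_prop)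
      (ae_of_all _ fun _ => ENNReal.ofReal_lt_top), ← integral_sub hpos hneg]
  refine integral_congr_ae (ae_of_all _ fun x => ?_)
  simp only [smul_eq_mul, ENNReal.toReal_ofReal']
  rw [← sub_mul, max_zero_sub_max_neg_zero_eq_self]
  ring

lemma norm_inv_one_add_mul_inv_pow_le {s g : ℝ} (hs : |s| < 1 / 2) (hg : 0 < g) (n : ℕ) :
    ‖((1 + s * (1 + g)⁻¹) ^ n)⁻¹‖ ≤ 2 ^ n := by
  simpa using norm_pow_div_one_add_mul_pow_le (abs_inv_one_add_le_one hg) (by simpa using hs) 0 n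

/-- Moving the negative part of `ρ` to the other side reduces the claim to the uniqueness of
positive measures. -/
lemma ae_nonneg_and_eq_withDensity_of_integral_inv_one_add_mul_inv_pow_eq {L μ : Measure ℝ}
    [IsFiniteMeasure L] [SigmaFinite μ] (hL : ∀ᵐ g ∂L, 0 < g) (hμ : ∀ᵐ g ∂μ, 0 < g) {ρ : ℝ → ℝ}
    (hρ : Integrable ρ μ) {n : ℕ} (hn : n ≠ 0)
    (h : ∀ᶠ s in 𝓝 (0 : ℝ), ∫ g, ((1 + s * (1 + g)⁻¹) ^ n)⁻¹ ∂L =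
      ∫ g, ((1 + s * (1 + g)⁻¹) ^ n)⁻¹ * ρ g ∂μ) :
    (∀ᵐ g ∂μ, 0 ≤ ρ g) ∧ L = μ.withDensity fun g => ENNReal.ofReal (ρ g) := by
  set νpos := μ.withDensity fun g => ENNReal.ofReal (ρ g)
  set νneg := μ.withDensity fun g => ENNReal.ofReal (-ρ g)
  have : IsFiniteMeasure νpos := isFiniteMeasure_withDensity_ofReal hρ.2
  have : IsFiniteMeasure νneg := isFiniteMeasure_withDensity_ofReal hρ.neg.2
  have hpos : ∀ᵐ g ∂νpos, 0 < g := (withDensity_absolutelyContinuous _ _).ae_le hμ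
  have hneg : ∀ᵐ g ∂νneg, 0 < g := (withDensity_absolutelyContinuous _ _).ae_le hμ
  have hmeas (s : ℝ) : Measurable fun g : ℝ => ((1 + s * (1 + g)⁻¹) ^ n)⁻¹ := by fun_prop
  have hint {κ : Measure ℝ} [IsFiniteMeasure κ] (hκ : ∀ᵐ g ∂κ, 0 < g) {s : ℝ} (hs : |s| < 1 / 2) :
      Integrable (fun g => ((1 + s * (1 + g)⁻¹) ^ n)⁻¹) κ :=
    .of_bound (hmeas s).aestronglyMeasurable (2 ^ n)
      (hκ.mono fun g hg => norm_inv_one_add_mul_inv_pow_le hs hg n)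
  have key : L + νneg = νpos := by
    refine measure_eq_of_eventually_integral_inv_one_add_mul_inv_pow_eq
      (ae_add_measure_iff.2 ⟨hL, hneg⟩) hpos hn ?_
    filter_upwards [h, Metric.ball_mem_nhds (0 : ℝ) one_half_pos] with s hs hs2
    rw [mem_ball_zero_iff, Real.norm_eq_abs] at hs2
    rw [integral_add_measure (hint hL hs2) (hint hneg hs2), hs,
      ← integral_withDensity_ofReal_sub_integral_withDensity_ofReal_neg hρ.aemeasurable (hmeas s)
        (hρ.bdd_mul (hmeas s).aestronglyMeasurable
          (hμ.mono fun g hg => norm_inv_one_add_mul_inv_pow_le hs2 hg n)), sub_add_cancel]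
  have hle : νneg ≤ νpos := Measure.le_add_left le_rfl |>.trans_eq key
  have hnonneg := ae_nonneg_of_withDensity_ofReal_neg_le hρ.aemeasurable hle
  have hzero : νneg = 0 := withDensity_ofReal_neg_eq_zero hnonneg
  exact ⟨hnonneg, by rw [← add_zero L, ← hzero, key]⟩

/-! ### Mixing densities for the output SINR -/

lemma hasDerivAt_sub_div_add {c d g : ℝ} (hg : g + d ≠ 0) :
    HasDerivAt (fun g : ℝ => (g - c) / (g + d)) ((c + d) / (g + d) ^ 2) g := by
  refine (((hasDerivAt_id g).sub_const c).div ((hasDerivAt_id g).add_const d) hg).congr_deriv ?_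
  simp only [id]
  congr 1
  ring

lemma tendsto_sub_div_add_atTop (c d : ℝ) :
    Tendsto (fun g : ℝ => (g - c) / (g + d)) atTop (𝓝 1) := by
  have h : Tendsto (fun g : ℝ => 1 - (c + d) * (g + d)⁻¹) atTop (𝓝 (1 - (c + d) * 0)) :=
    ((tendsto_inv_atTop_zero.comp (tendsto_atTop_add_const_right _ d tendsto_id)).const_mul
      (c + d)).const_sub 1
  rw [mul_zero, sub_zero] at h
  refine h.congr' ?_
  filter_upwards [eventually_gt_atTop (-d)] with g hg
  have : g + d ≠ 0 := by linarith
  field_simp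
  ring

lemma integral_Ioi_comp_sub_div_add {c d : ℝ} (hcd : 0 < c + d) {Φ φ : ℝ → ℝ} {l : ℝ}
    (hderiv : ∀ r ∈ Ico (0 : ℝ) 1, HasDerivAt Φ (φ r) r) (hpos : ∀ r ∈ Ioo (0 : ℝ) 1, 0 ≤ φ r)
    (hlim : Tendsto Φ (𝓝[<] 1) (𝓝 l)) :
    ∫ g in Ioi c, φ ((g - c) / (g + d)) * ((c + d) / (g + d) ^ 2) = l - Φ 0 := by
  have ratio_lt_one {g : ℝ} (hg : c ≤ g) : (g - c) / (g + d) < 1 := by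
    rw [div_lt_one] <;> linarith
  have tendsto_ratio : Tendsto (fun g => (g - c) / (g + d)) atTop (𝓝[<] 1) :=
    tendsto_nhdsWithin_iff.2 ⟨tendsto_sub_div_add_atTop c d,
      (eventually_ge_atTop c).mono fun g hg => ratio_lt_one hg⟩
  have h := integral_Ioi_of_hasDerivAt_of_nonneg' (g := Φ ∘ fun g => (g - c) / (g + d))
    (fun g (hg : c ≤ g) => (hderiv _ ⟨div_nonneg (by linarith) (by linarith),
      ratio_lt_one hg⟩).comp g (hasDerivAt_sub_div_add (by linarith)))
    (fun g (hg : c < g) => mul_nonneg (hpos _ ⟨div_pos (by linarith) (by linarith),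
      ratio_lt_one hg.le⟩) (by positivity)) (hlim.comp tendsto_ratio)
  simpa using h

lemma integral_Ioi_sub_div_add_pow {n : ℕ} (hn : 2 ≤ n) {c d : ℝ} (hcd : 0 < c + d) :
    ∫ g in Ioi c, ((n : ℝ) - 1) * ((g - c) / (g + d)) ^ (n - 2) * ((c + d) / (g + d) ^ 2) = 1 := by
  obtain ⟨m, rfl⟩ := Nat.exists_eq_add_of_le' hn
  have h := integral_Ioi_comp_sub_div_add hcd (Φ := fun r => r ^ (m + 1))
    (φ := fun r => ((m + 1 : ℕ) : ℝ) * r ^ m) (fun r _ => hasDerivAt_pow (m + 1) r)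
    (fun r hr => mul_nonneg (Nat.cast_nonneg _) (pow_nonneg hr.1.le m))
    ((continuous_pow (m + 1)).tendsto' 1 1 (one_pow _) |>.mono_left nhdsWithin_le_nhds)
  simpa [show (m : ℝ) + 2 - 1 = m + 1 by ring] using h

lemma tendsto_one_sub_pow_mul_log_one_sub (m : ℕ) :
    Tendsto (fun r : ℝ => (1 - r ^ m) * Real.log (1 - r)) (𝓝[<] 1) (𝓝 0) := by
  have h0 : Tendsto (fun r : ℝ => 1 - r) (𝓝[<] 1) (𝓝[>] 0) := by
    refine tendsto_nhdsWithin_iff.2 ⟨?_, ?_⟩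
    · exact (continuous_const.sub continuous_id).tendsto' 1 0 (sub_self 1) |>.mono_left
        nhdsWithin_le_nhds
    · filter_upwards [self_mem_nhdsWithin] with r (hr : r < 1) using sub_pos.2 hr
  have h1 : Tendsto (fun x : ℝ => Real.log x * x) (𝓝[>] 0) (𝓝 0) := by
    simpa using tendsto_log_mul_rpow_nhdsGT_zero (r := 1) one_pos
  have h2 : Tendsto (fun r : ℝ => ∑ j ∈ Finset.range m, r ^ j) (𝓝[<] 1)
      (𝓝 (∑ j ∈ Finset.range m, 1 ^ j)) :=
    (Continuous.tendsto (by fun_prop) _).mono_left nhdsWithin_le_nhds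
  have h3 := (h1.comp h0).mul h2
  rw [zero_mul] at h3
  refine h3.congr fun r => ?_
  rw [← mul_neg_geom_sum r m]
  simp only [Function.comp]
  ring

lemma hasDerivAt_one_sub_pow_mul_log_one_sub_add_sum (m : ℕ) {r : ℝ} (hr : r < 1) :
    HasDerivAt (fun r : ℝ => (1 - r ^ m) * Real.log (1 - r) +
      ∑ j ∈ Finset.range m, r ^ (j + 1) / ((j : ℝ) + 1))
      (-(m * r ^ (m - 1) * Real.log (1 - r))) r := by
  have h1 : (1 - r) ≠ 0 := by linarith
  have hl : HasDerivAt (fun r : ℝ => Real.log (1 - r)) (-1 / (1 - r)) r :=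
    ((hasDerivAt_id r).const_sub 1).log h1
  have hp : HasDerivAt (fun r : ℝ => 1 - r ^ m) (-(m * r ^ (m - 1))) r :=
    (hasDerivAt_pow m r).const_sub 1
  have hs : HasDerivAt (fun r : ℝ => ∑ j ∈ Finset.range m, r ^ (j + 1) / ((j : ℝ) + 1))
      (∑ j ∈ Finset.range m, r ^ j) r := by
    refine HasDerivAt.fun_sum fun j _ => ?_
    refine ((hasDerivAt_pow (j + 1) r).div_const ((j : ℝ) + 1)).congr_deriv ?_
    have : (j : ℝ) + 1 ≠ 0 := by positivity
    rw [Nat.add_sub_cancel]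
    push_cast
    field_simp
  refine ((hp.mul hl).add hs).congr_deriv ?_
  rw [← mul_neg_geom_sum r m]
  field_simp
  ring

lemma integral_Ioi_sub_div_add_pow_mul_log {n : ℕ} (hn : 2 ≤ n) {c d : ℝ} (hcd : 0 < c + d) :
    ∫ g in Ioi c, ((n : ℝ) - 1) * ((g - c) / (g + d)) ^ (n - 2) * ((c + d) / (g + d) ^ 2) *
      Real.log ((g + d) / (c + d)) = (harmonic (n - 1) : ℝ) := by
  obtain ⟨m, rfl⟩ := Nat.exists_eq_add_of_le' hn
  have h := integral_Ioi_comp_sub_div_add hcd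
    (fun r hr => hasDerivAt_one_sub_pow_mul_log_one_sub_add_sum (m + 1) hr.2)
    (fun r hr => neg_nonneg.2 (mul_nonpos_of_nonneg_of_nonpos
      (mul_nonneg (Nat.cast_nonneg _) (pow_nonneg hr.1.le _))
      (Real.log_nonpos (by linarith [hr.2]) (by linarith [hr.1]))))
    ((tendsto_one_sub_pow_mul_log_one_sub (m + 1)).add
      ((Continuous.tendsto (by fun_prop) _).mono_left nhdsWithin_le_nhds))
  refine (setIntegral_congr_fun measurableSet_Ioi fun g (hg : c < g) => ?_).trans
    (h.trans (by simp [harmonic]))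
  have hgd : g + d ≠ 0 := by linarith
  have : 1 - (g - c) / (g + d) = ((g + d) / (c + d))⁻¹ := by field_simp; ring
  simp only [this, Real.log_inv, Nat.add_sub_cancel]
  push_cast
  ring

/-- For `c > 0` the probability density on `(c, ∞)` of `(1 + c) / t - 1`, where `t` is
`Beta(1, n - 1)`-distributed; the density of the SINR is a signed mixture of these. The formula is
written as the push-forward of `(n - 1) r ^ (n - 2) dr` under the inverse of
`g ↦ (g - c) / (g + 1)`, and it is a density only for `2 ≤ n` because of the truncated `n - 2`. -/
noncomputable def sinrMixingKernel (n : ℕ) (c g : ℝ) : ℝ :=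
  (Ioi c).indicator
    (fun g => ((n : ℝ) - 1) * ((g - c) / (g + 1)) ^ (n - 2) * ((c + 1) / (g + 1) ^ 2)) g

lemma sinrMixingKernel_nonneg {n : ℕ} (hn : 1 ≤ n) {c : ℝ} (hc : 0 < c) (g : ℝ) :
    0 ≤ sinrMixingKernel n c g := by
  refine indicator_nonneg (fun g (hg : c < g) => ?_) g
  have : 0 ≤ (n : ℝ) - 1 := sub_nonneg.2 (by exact_mod_cast hn)
  have : 0 ≤ g - c := by linarith
  have : 0 < g + 1 := by linarith
  positivity

lemma measurable_sinrMixingKernel (n : ℕ) :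
    Measurable fun z : ℝ × ℝ => sinrMixingKernel n z.1 z.2 :=
  Measurable.indicator (s := {z : ℝ × ℝ | z.1 < z.2})
    (f := fun z => ((n : ℝ) - 1) * ((z.2 - z.1) / (z.2 + 1)) ^ (n - 2) *
      ((z.1 + 1) / (z.2 + 1) ^ 2)) (by fun_prop) (measurableSet_lt measurable_fst measurable_snd)

lemma setIntegral_sinrMixingKernel_mul (n : ℕ) {c : ℝ} (hc : 0 ≤ c) (f : ℝ → ℝ) :
    ∫ g in Ioi (0 : ℝ), sinrMixingKernel n c g * f g =
      ∫ g in Ioi c, ((n : ℝ) - 1) * ((g - c) / (g + 1)) ^ (n - 2) * ((c + 1) / (g + 1) ^ 2) *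
        f g := by
  simp only [sinrMixingKernel, ← indicator_mul_left]
  rw [setIntegral_indicator measurableSet_Ioi, inter_eq_right.2 (Ioi_subset_Ioi hc)]

lemma integral_sinrMixingKernel_mul_inv_one_add_mul_inv_pow {n : ℕ} (hn : 2 ≤ n) {c s : ℝ}
    (hc : 0 < c) (hs : -1 < s) :
    ∫ g in Ioi (0 : ℝ), sinrMixingKernel n c g * ((1 + s * (1 + g)⁻¹) ^ n)⁻¹ =
      (1 + s * (1 + c)⁻¹)⁻¹ := by
  have hcs : 0 < c + (1 + s) := by linarith
  have key : ∀ g ∈ Ioi c, ((n : ℝ) - 1) * ((g - c) / (g + 1)) ^ (n - 2) *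
      ((c + 1) / (g + 1) ^ 2) * ((1 + s * (1 + g)⁻¹) ^ n)⁻¹ =
      (1 + s * (1 + c)⁻¹)⁻¹ * (((n : ℝ) - 1) * ((g - c) / (g + (1 + s))) ^ (n - 2) *
        ((c + (1 + s)) / (g + (1 + s)) ^ 2)) := by
    intro g (hg : c < g)
    obtain ⟨m, rfl⟩ := Nat.exists_eq_add_of_le' hn
    have h1 : g + 1 ≠ 0 := by linarith
    have h2 : g + (1 + s) ≠ 0 := by linarith
    have h3 : c + 1 ≠ 0 := by linarith
    have h4 : 1 + s * (1 + g)⁻¹ = (g + (1 + s)) / (g + 1) := by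
      rw [add_comm 1 g]; field_simp; ring
    have h5 : 1 + s * (1 + c)⁻¹ = (c + (1 + s)) / (c + 1) := by
      rw [add_comm 1 c]; field_simp; ring
    simp only [h4, h5, div_pow, Nat.add_sub_cancel]
    field_simp
    ring
  rw [setIntegral_sinrMixingKernel_mul n hc.le, setIntegral_congr_fun measurableSet_Ioi key,
    integral_const_mul, integral_Ioi_sub_div_add_pow hn hcs, mul_one]

lemma integral_sinrMixingKernel {n : ℕ} (hn : 2 ≤ n) {c : ℝ} (hc : 0 < c) :
    ∫ g in Ioi (0 : ℝ), sinrMixingKernel n c g = 1 := by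
  simpa using integral_sinrMixingKernel_mul_inv_one_add_mul_inv_pow hn (s := 0) hc (by norm_num)

lemma integral_sinrMixingKernel_mul_log {n : ℕ} (hn : 2 ≤ n) {c : ℝ} (hc : 0 < c) :
    ∫ g in Ioi (0 : ℝ), sinrMixingKernel n c g * Real.log (1 + g) =
      Real.log (1 + c) + (harmonic (n - 1) : ℝ) := by
  have hc1 : 0 < c + 1 := by linarith
  have hharm : (harmonic (n - 1) : ℝ) ≠ 0 := by
    exact_mod_cast (harmonic_pos (by omega)).ne'
  have hmass := integral_Ioi_sub_div_add_pow hn hc1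
  have hlog := integral_Ioi_sub_div_add_pow_mul_log hn hc1
  have hmass_int := Integrable.of_integral_ne_zero (hmass.trans_ne one_ne_zero)
  have hlog_int := Integrable.of_integral_ne_zero (hlog.trans_ne hharm)
  calc ∫ g in Ioi (0 : ℝ), sinrMixingKernel n c g * Real.log (1 + g)
      = ∫ g in Ioi c, (((n : ℝ) - 1) * ((g - c) / (g + 1)) ^ (n - 2) * ((c + 1) / (g + 1) ^ 2) *
            Real.log (1 + c) +
          ((n : ℝ) - 1) * ((g - c) / (g + 1)) ^ (n - 2) * ((c + 1) / (g + 1) ^ 2) *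
            Real.log ((g + 1) / (c + 1))) := by
        rw [setIntegral_sinrMixingKernel_mul n hc.le]
        refine setIntegral_congr_fun measurableSet_Ioi fun g (hg : c < g) => ?_
        have hg1 : g + 1 ≠ 0 := by linarith
        simp only [Real.log_div hg1 hc1.ne']
        rw [add_comm 1 g, add_comm 1 c]
        ring
    _ = Real.log (1 + c) + (harmonic (n - 1) : ℝ) := by
        rw [integral_add (hmass_int.mul_const _) hlog_int, integral_mul_const, hmass, hlog, one_mul]

lemma integrable_prod_mul_of_ae_integral_eq {α β : Type*} [MeasurableSpace α] [MeasurableSpace β]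
    {μ : Measure α} {ν : Measure β} [SFinite ν] {k : α → β → ℝ} {w F : α → ℝ}
    (hk : AEStronglyMeasurable (Function.uncurry k) (μ.prod ν))
    (hk0 : ∀ᵐ y ∂μ, 0 ≤ᵐ[ν] k y) (hki : ∀ᵐ y ∂μ, Integrable (k y) ν)
    (hkF : ∀ᵐ y ∂μ, ∫ g, k y g ∂ν = F y) (hw : AEStronglyMeasurable w μ)
    (hwF : Integrable (fun y => w y * F y) μ) :
    Integrable (Function.uncurry fun y g => w y * k y g) (μ.prod ν) := by
  refine (integrable_prod_iff (hw.comp_fst.mul hk)).2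
    ⟨hki.mono fun y hy => hy.const_mul (w y), hwF.norm.congr ?_⟩
  filter_upwards [hk0, hkF] with y hy0 hyF
  have hnorm : ∀ᵐ g ∂ν, ‖w y * k y g‖ = ‖w y‖ * k y g :=
    hy0.mono fun g hg => by rw [norm_mul, Real.norm_of_nonneg hg]
  have hF0 : 0 ≤ F y := hyF ▸ integral_nonneg_of_ae hy0
  rw [norm_mul, Real.norm_of_nonneg hF0, ← hyF, ← integral_const_mul]
  exact (integral_congr_ae hnorm).symm

/-- The candidate density of the output SINR; `w` stands for the section `K(-1/δ, ·)` of the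
kernel. -/
noncomputable def sinrDensity (n : ℕ) (δ : ℝ) (w : ℝ → ℝ) (g : ℝ) : ℝ :=
  ((n : ℝ) - 1) / δ * (g / (g + 1)) ^ n *
    ∫ x in (0 : ℝ)..1, (1 - x) ^ (n - 2) * (x + 1 / g) * w (g / δ * x)

lemma intervalIntegrable_mul_comp_mul {w φ : ℝ → ℝ} {c : ℝ} (hc : 0 < c)
    (hw : IntegrableOn w (Ioi 0)) (hφ : Continuous φ) :
    IntervalIntegrable (fun x => φ x * w (c * x)) volume 0 1 := by
  have h1 : IntervalIntegrable w volume 0 c :=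
    (intervalIntegrable_iff_integrableOn_Ioc_of_le hc.le).2 (hw.mono_set Ioc_subset_Ioi_self)
  have h2 := h1.comp_mul_left (c := c)
  rw [zero_div, div_self hc.ne'] at h2
  exact h2.continuousOn_mul hφ.continuousOn

section sinrDensity

variable {n : ℕ} {δ : ℝ} {w : ℝ → ℝ}

lemma sinrMixingKernel_eq_indicator_Iio (hn : 2 ≤ n) (hδ : 0 < δ) {g : ℝ} (hg : 0 < g) (y : ℝ) :
    sinrMixingKernel n (δ * y) g = (Iio (g / δ)).indicator (fun y =>
      ((n : ℝ) - 1) / δ * (g / (g + 1)) ^ n *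
        ((g / δ)⁻¹ * ((1 - y / (g / δ)) ^ (n - 2) * (y / (g / δ) + 1 / g)))) y := by
  have hmem : δ * y < g ↔ y < g / δ := by rw [lt_div_iff₀ hδ, mul_comm]
  by_cases hy : y < g / δ
  · rw [sinrMixingKernel, indicator_of_mem (mem_Ioi.2 (hmem.2 hy)), indicator_of_mem (mem_Iio.2 hy)]
    obtain ⟨m, rfl⟩ := Nat.exists_eq_add_of_le' hn
    have h1 : 1 - y / (g / δ) = (g - δ * y) / g := by field_simp
    simp only [h1, div_pow, Nat.add_sub_cancel]
    field_simp
    ring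
  · rw [sinrMixingKernel, indicator_of_notMem (mt mem_Ioi.1 (mt hmem.1 hy)),
      indicator_of_notMem (mt mem_Iio.1 hy)]

lemma sinrDensity_eq_integral_sinrMixingKernel (hn : 2 ≤ n) (hδ : 0 < δ) {g : ℝ} (hg : 0 < g) :
    sinrDensity n δ w g = ∫ y in Ioi (0 : ℝ), w y * sinrMixingKernel n (δ * y) g := by
  have hc : 0 < g / δ := div_pos hg hδ
  have hsubst := intervalIntegral.integral_comp_mul_left (a := 0) (b := 1)
    (fun y => (1 - y / (g / δ)) ^ (n - 2) * (y / (g / δ) + 1 / g) * w y) hc.ne'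
  simp only [mul_div_cancel_left₀ _ hc.ne', mul_zero, mul_one] at hsubst
  simp only [sinrMixingKernel_eq_indicator_Iio hn hδ hg, ← indicator_mul_right]
  rw [sinrDensity, hsubst, setIntegral_indicator measurableSet_Iio, Ioi_inter_Iio,
    intervalIntegral.integral_of_le hc.le, integral_Ioc_eq_integral_Ioo, smul_eq_mul,
    ← integral_const_mul, ← integral_const_mul]
  exact integral_congr_ae (ae_of_all _ fun y => by ring)

lemma integrable_prod_mul_sinrMixingKernel (hn : 1 ≤ n) (hδ : 0 < δ) (hw : IntegrableOn w (Ioi 0))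
    {f F : ℝ → ℝ} (hf : Measurable f) (hf0 : ∀ g, 0 < g → 0 ≤ f g) (hF0 : ∀ c, 0 < c → 0 < F c)
    (hF : ∀ c, 0 < c → ∫ g in Ioi (0 : ℝ), sinrMixingKernel n c g * f g = F c)
    (hwF : IntegrableOn (fun y => w y * F (δ * y)) (Ioi 0)) :
    Integrable (Function.uncurry fun y g => w y * (sinrMixingKernel n (δ * y) g * f g))
      ((volume.restrict (Ioi 0)).prod (volume.restrict (Ioi 0))) := by
  have hδy : ∀ᵐ y ∂volume.restrict (Ioi (0 : ℝ)), 0 < δ * y :=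
    (ae_restrict_mem measurableSet_Ioi).mono fun y hy => mul_pos hδ hy
  have hk : Measurable (Function.uncurry fun y g => sinrMixingKernel n (δ * y) g * f g) :=
    ((measurable_sinrMixingKernel n).comp (by fun_prop : Measurable fun z : ℝ × ℝ =>
      (δ * z.1, z.2))).mul (hf.comp measurable_snd)
  refine integrable_prod_mul_of_ae_integral_eq hk.aestronglyMeasurable ?_ ?_
    (hδy.mono fun y hy => hF _ hy) hw.aestronglyMeasurable hwF
  · filter_upwards [hδy] with y hy
    filter_upwards [ae_restrict_mem measurableSet_Ioi] with g hg
      using mul_nonneg (sinrMixingKernel_nonneg hn hy g) (hf0 g hg)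
  · exact hδy.mono fun y hy => .of_integral_ne_zero ((hF _ hy).trans_ne (hF0 _ hy).ne')

lemma sinrDensity_mul_eq_integral (hn : 2 ≤ n) (hδ : 0 < δ) {g : ℝ} (hg : 0 < g) (f : ℝ → ℝ) :
    sinrDensity n δ w g * f g =
      ∫ y in Ioi (0 : ℝ), w y * (sinrMixingKernel n (δ * y) g * f g) := by
  simp only [sinrDensity_eq_integral_sinrMixingKernel hn hδ hg, ← integral_mul_const, mul_assoc]

lemma integrableOn_sinrDensity_mul (hn : 2 ≤ n) (hδ : 0 < δ) {f : ℝ → ℝ}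
    (hint : Integrable (Function.uncurry fun y g => w y * (sinrMixingKernel n (δ * y) g * f g))
      ((volume.restrict (Ioi 0)).prod (volume.restrict (Ioi 0)))) :
    IntegrableOn (fun g => sinrDensity n δ w g * f g) (Ioi 0) :=
  IntegrableOn.congr_fun hint.integral_prod_right
    (fun _ hg => (sinrDensity_mul_eq_integral hn hδ hg f).symm) measurableSet_Ioi

lemma setIntegral_sinrDensity_mul (hn : 2 ≤ n) (hδ : 0 < δ) {f : ℝ → ℝ}
    (hint : Integrable (Function.uncurry fun y g => w y * (sinrMixingKernel n (δ * y) g * f g))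
      ((volume.restrict (Ioi 0)).prod (volume.restrict (Ioi 0)))) :
    ∫ g in Ioi (0 : ℝ), sinrDensity n δ w g * f g =
      ∫ y in Ioi (0 : ℝ), w y * ∫ g in Ioi (0 : ℝ), sinrMixingKernel n (δ * y) g * f g := by
  rw [setIntegral_congr_fun measurableSet_Ioi fun g hg => sinrDensity_mul_eq_integral hn hδ hg f,
    ← integral_integral_swap hint]
  simp only [integral_const_mul]

lemma integrableOn_sinrDensity (hn : 2 ≤ n) (hδ : 0 < δ) (hw : IntegrableOn w (Ioi 0)) :
    IntegrableOn (sinrDensity n δ w) (Ioi 0) := by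
  have hint := integrable_prod_mul_sinrMixingKernel (one_le_two.trans hn) hδ hw (f := 1) (F := 1)
    measurable_one (fun _ _ => zero_le_one) (fun _ _ => one_pos)
    (fun c hc => by simpa using integral_sinrMixingKernel hn hc) (by simpa using hw)
  simpa using integrableOn_sinrDensity_mul hn hδ hint

lemma one_add_mul_inv_pos {s x : ℝ} (hs : -1 < s) (hx : 1 ≤ x) : 0 < 1 + s * x⁻¹ := by
  have : 0 < x := by linarith
  field_simp
  linarith

lemma integral_sinrDensity_mul_inv_one_add_mul_inv_pow (hn : 2 ≤ n) (hδ : 0 < δ)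
    (hw : IntegrableOn w (Ioi 0)) {s : ℝ} (hs : -1 < s)
    (hws : IntegrableOn (fun y => w y * (1 + s * (1 + δ * y)⁻¹)⁻¹) (Ioi 0)) :
    ∫ g in Ioi (0 : ℝ), sinrDensity n δ w g * ((1 + s * (1 + g)⁻¹) ^ n)⁻¹ =
      ∫ y in Ioi (0 : ℝ), w y * (1 + s * (1 + δ * y)⁻¹)⁻¹ := by
  have hpos (c : ℝ) (hc : 0 < c) : 0 < 1 + s * (1 + c)⁻¹ :=
    one_add_mul_inv_pos hs (le_add_of_nonneg_right hc.le)
  have hint := integrable_prod_mul_sinrMixingKernel (one_le_two.trans hn) hδ hw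
    (f := fun g => ((1 + s * (1 + g)⁻¹) ^ n)⁻¹) (F := fun c => (1 + s * (1 + c)⁻¹)⁻¹)
    (by fun_prop) (fun g hg => (inv_pos.2 (pow_pos (hpos g hg) n)).le)
    (fun c hc => inv_pos.2 (hpos c hc))
    (fun c hc => integral_sinrMixingKernel_mul_inv_one_add_mul_inv_pow hn hc hs) hws
  rw [setIntegral_sinrDensity_mul hn hδ hint]
  refine setIntegral_congr_fun measurableSet_Ioi fun y (hy : 0 < y) => ?_
  simp only [integral_sinrMixingKernel_mul_inv_one_add_mul_inv_pow hn (mul_pos hδ hy) hs]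

lemma integrable_prod_mul_sinrMixingKernel_mul_log (hn : 2 ≤ n) (hδ : 0 < δ)
    (hw : IntegrableOn w (Ioi 0))
    (hwlog : IntegrableOn (fun y => Real.log (1 + δ * y) * w y) (Ioi 0)) :
    Integrable (Function.uncurry fun y g =>
      w y * (sinrMixingKernel n (δ * y) g * Real.log (1 + g)))
      ((volume.restrict (Ioi 0)).prod (volume.restrict (Ioi 0))) := by
  have hharm : 0 < harmonic (n - 1) := harmonic_pos (by omega)
  refine integrable_prod_mul_sinrMixingKernel (one_le_two.trans hn) hδ hw
    (F := fun c => Real.log (1 + c) + (harmonic (n - 1) : ℝ)) (by fun_prop)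
    (fun g hg => Real.log_nonneg (by linarith))
    (fun c hc => add_pos (Real.log_pos (by linarith)) (by exact_mod_cast hharm))
    (fun c hc => integral_sinrMixingKernel_mul_log hn hc) ?_
  simp only [mul_add, mul_comm (w _) (Real.log _)]
  exact hwlog.add (hw.mul_const _)

lemma integral_sinrDensity_mul_log (hn : 2 ≤ n) (hδ : 0 < δ) (hw : IntegrableOn w (Ioi 0))
    (hwlog : IntegrableOn (fun y => Real.log (1 + δ * y) * w y) (Ioi 0)) :
    ∫ g in Ioi (0 : ℝ), sinrDensity n δ w g * Real.log (1 + g) =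
      (∫ y in Ioi (0 : ℝ), Real.log (1 + δ * y) * w y) +
        (∫ y in Ioi (0 : ℝ), w y) * (harmonic (n - 1) : ℝ) := by
  rw [setIntegral_sinrDensity_mul hn hδ
    (integrable_prod_mul_sinrMixingKernel_mul_log hn hδ hw hwlog),
    ← integral_mul_const, ← integral_add hwlog (hw.mul_const _)]
  refine setIntegral_congr_fun measurableSet_Ioi fun y (hy : 0 < y) => ?_
  simp only [integral_sinrMixingKernel_mul_log hn (mul_pos hδ hy)]
  ring

end sinrDensity

/-! ### Averages over the unitary group -/

section UnitaryHaar

variable {n : ℕ}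

instance : (unitaryHaar n).IsHaarMeasure := by
  unfold unitaryHaar; infer_instance

instance : IsProbabilityMeasure (unitaryHaar n) :=
  ⟨by unfold unitaryHaar; exact Measure.haarMeasure_self⟩

instance : (unitaryHaar n).IsMulRightInvariant :=
  ⟨fun V => by
    have : IsProbabilityMeasure ((unitaryHaar n).map (· * V)) :=
      Measure.isProbabilityMeasure_map (by fun_prop)
    exact Measure.isHaarMeasure_eq_of_isProbabilityMeasure _ _⟩

lemma exists_unitary_norm_smul_col_eq {ι : Type*} [Fintype ι] [DecidableEq ι] (z : ι → ℂ) (k : ι) :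
    ∃ V : Matrix.unitaryGroup ι ℂ, (‖WithLp.toLp 2 z‖ : ℂ) • V.1.col k = z := by
  set e : EuclideanSpace ℂ ι := WithLp.toLp 2 z with he
  by_cases h0 : e = 0
  · exact ⟨1, by simpa [← he, h0] using (WithLp.toLp_eq_zero 2).1 h0 |>.symm⟩
  have hr : (‖e‖ : ℂ) ≠ 0 := by exact_mod_cast norm_ne_zero_iff.2 h0
  have hv : Orthonormal ℂ (({k} : Set ι).domRestrict fun _ : ι => (‖e‖ : ℂ)⁻¹ • e) := by
    refine ⟨fun i => ?_, fun i j hij => absurd (Subsingleton.elim i j) hij⟩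
    simp [norm_smul, norm_ne_zero_iff.2 h0]
  obtain ⟨b, hb⟩ := hv.exists_orthonormalBasis_extension_of_card_eq (by simp)
  refine ⟨⟨_, (EuclideanSpace.basisFun ι ℂ).toMatrix_orthonormalBasis_mem_unitary b⟩, ?_⟩
  ext a
  simpa [Module.Basis.toMatrix_apply, hb k rfl] using mul_inv_cancel_left₀ hr (z a)

lemma measurePreserving_mulVec_of_norm_det_eq_one {ι : Type*} [Fintype ι] [DecidableEq ι]
    {M : Matrix ι ι ℂ} (hM : ‖M.det‖ = 1) :
    MeasurePreserving (fun z : ι → ℂ => M *ᵥ z) := by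
  have hdet : LinearMap.det ((Matrix.toLin' M).restrictScalars ℝ) = 1 := by
    have h := LinearMap.det_restrictScalars (R := ℝ) (f := Matrix.toLin' M)
    rw [h, LinearMap.det_toLin', Algebra.norm_complex_apply, Complex.normSq_eq_norm_sq, hM, one_pow]
  refine ⟨by fun_prop, ?_⟩
  have h := Measure.map_linearMap_addHaar_eq_smul_addHaar (volume : Measure (ι → ℂ))
    (hdet.trans_ne one_ne_zero)
  rw [hdet, inv_one, abs_one, ENNReal.ofReal_one, one_smul] at h
  exact h

lemma norm_det_unitary {ι : Type*} [Fintype ι] [DecidableEq ι] (U : Matrix.unitaryGroup ι ℂ) :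
    ‖U.1.det‖ = 1 :=
  CStarRing.norm_of_mem_unitary (Matrix.det_of_mem_unitary U.2)

/- Averaging `∫ f (U z) dz = ∫ f` over `U` and using right invariance, `z` may be replaced by the
vector of the same length in the direction of the `k`-th basis vector. -/
lemma lintegral_unitaryHaar_norm_smul_col (k : Fin n) {f : (Fin n → ℂ) → ENNReal}
    (hf : Measurable f) :
    ∫⁻ U : Matrix.unitaryGroup (Fin n) ℂ, ∫⁻ z : Fin n → ℂ,
      f ((‖WithLp.toLp 2 z‖ : ℂ) • U.1.col k) ∂volume ∂unitaryHaar n = ∫⁻ z, f z := by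
  have hscale : Measurable fun x : Matrix.unitaryGroup (Fin n) ℂ × (Fin n → ℂ) =>
      (‖WithLp.toLp 2 x.2‖ : ℂ) • x.1.1.col k := by
    have hnorm : Continuous fun x : Matrix.unitaryGroup (Fin n) ℂ × (Fin n → ℂ) =>
        (‖WithLp.toLp 2 x.2‖ : ℂ) := by fun_prop
    exact (hnorm.smul <| continuous_pi fun a =>
      (continuous_subtype_val.comp continuous_fst).matrix_elem a k).measurable
  have hmul : Measurable fun x : Matrix.unitaryGroup (Fin n) ℂ × (Fin n → ℂ) => x.1.1 *ᵥ x.2 :=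
    Continuous.measurable (by fun_prop)
  have hz (z : Fin n → ℂ) : ∫⁻ U : Matrix.unitaryGroup (Fin n) ℂ,
      f ((‖WithLp.toLp 2 z‖ : ℂ) • U.1.col k) ∂unitaryHaar n =
      ∫⁻ U : Matrix.unitaryGroup (Fin n) ℂ, f (U.1 *ᵥ z) ∂unitaryHaar n := by
    obtain ⟨V, hV⟩ := exists_unitary_norm_smul_col_eq z k
    rw [← lintegral_mul_right_eq_self _ V]
    refine lintegral_congr fun U => ?_
    conv_rhs => rw [← hV]
    rw [← Matrix.mulVec_single_one, ← Matrix.mulVec_single_one, Matrix.mulVec_smul,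
      Matrix.mulVec_mulVec]
    rfl
  calc _ = ∫⁻ z : Fin n → ℂ, ∫⁻ U : Matrix.unitaryGroup (Fin n) ℂ,
          f ((‖WithLp.toLp 2 z‖ : ℂ) • U.1.col k) ∂unitaryHaar n :=
        lintegral_lintegral_swap (f := fun (U : Matrix.unitaryGroup (Fin n) ℂ) z =>
          f ((‖WithLp.toLp 2 z‖ : ℂ) • U.1.col k)) (hf.comp hscale).aemeasurable
    _ = ∫⁻ z : Fin n → ℂ, ∫⁻ U : Matrix.unitaryGroup (Fin n) ℂ, f (U.1 *ᵥ z) ∂unitaryHaar n :=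
        lintegral_congr hz
    _ = ∫⁻ U : Matrix.unitaryGroup (Fin n) ℂ, ∫⁻ z : Fin n → ℂ, f (U.1 *ᵥ z) ∂volume
          ∂unitaryHaar n :=
        (lintegral_lintegral_swap (f := fun (U : Matrix.unitaryGroup (Fin n) ℂ) z => f (U.1 *ᵥ z))
          (hf.comp hmul).aemeasurable).symm
    _ = ∫⁻ z, f z := by
        simp only [(measurePreserving_mulVec_of_norm_det_eq_one (norm_det_unitary _)).lintegral_comp
          hf, lintegral_const, measure_univ, mul_one]

/-- The quadratic form `∑ a, D a |z a|²`. On the `k`-th column of a unitary matrix `U` it is the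
`k`-th diagonal entry of `Uᴴ D U`. -/
noncomputable def weightedNormSq {ι : Type*} [Fintype ι] (D : ι → ℝ) (z : ι → ℂ) : ℝ :=
  ∑ a, D a * ‖z a‖ ^ 2

section weightedNormSq

variable {ι : Type*} [Fintype ι] {D : ι → ℝ}

lemma continuous_weightedNormSq (D : ι → ℝ) : Continuous (weightedNormSq D) := by
  unfold weightedNormSq; fun_prop

lemma weightedNormSq_norm_smul (D : ι → ℝ) (z w : ι → ℂ) :
    weightedNormSq D ((‖WithLp.toLp 2 z‖ : ℂ) • w) =
      weightedNormSq (fun _ => weightedNormSq D w) z := by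
  simp only [weightedNormSq, Pi.smul_apply, norm_smul, mul_pow, Complex.norm_real, norm_norm,
    EuclideanSpace.norm_sq_eq]
  rw [← Finset.mul_sum, Finset.sum_mul]
  exact Finset.sum_congr rfl fun a _ => by ring

lemma weightedNormSq_pos (hD : ∀ a, 0 < D a) {z : ι → ℂ} (hz : z ≠ 0) : 0 < weightedNormSq D z := by
  obtain ⟨a, ha⟩ := Function.ne_iff.1 hz
  have : 0 < ‖z a‖ := norm_pos_iff.2 ha
  exact Finset.sum_pos' (fun b _ => mul_nonneg (hD b).le (by positivity))
    ⟨a, Finset.mem_univ a, mul_pos (hD a) (by positivity)⟩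

lemma lintegral_exp_neg_weightedNormSq (hD : ∀ a, 0 < D a) :
    ∫⁻ z : ι → ℂ, ENNReal.ofReal (Real.exp (-weightedNormSq D z)) =
      ENNReal.ofReal (∏ a, Real.pi / D a) := by
  have hgauss (a : ι) : ∫ z : ℂ, Real.exp (-(D a * ‖z‖ ^ 2)) = Real.pi / D a := by
    simpa using GaussianFourier.integral_rexp_neg_mul_sq_norm (V := ℂ) (hD a)
  have hint (a : ι) : Integrable fun z : ℂ => Real.exp (-(D a * ‖z‖ ^ 2)) :=
    .of_integral_ne_zero ((hgauss a).trans_ne (div_pos Real.pi_pos (hD a)).ne')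
  have hprod (z : ι → ℂ) :
      Real.exp (-weightedNormSq D z) = ∏ a, Real.exp (-(D a * ‖z a‖ ^ 2)) := by
    rw [weightedNormSq, ← Finset.sum_neg_distrib, Real.exp_sum]
  simp only [hprod, ← hgauss]
  rw [volume_pi, ← integral_fintype_prod_eq_prod, ofReal_integral_eq_lintegral_ofReal
    (.fintype_prod hint) (ae_of_all _ fun z => Finset.prod_nonneg fun a _ => (Real.exp_pos _).le)]

end weightedNormSq

section unitaryConjDiagonal

variable {ι : Type*} [Fintype ι] [DecidableEq ι]

/-- The Hermitian matrix `Uᴴ diag(l) U`, the model for `Hᴴ H` in an invariant ensemble. -/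
noncomputable def unitaryConjDiagonal (U : Matrix.unitaryGroup ι ℂ) (l : ι → ℝ) : Matrix ι ι ℂ :=
  U.1ᴴ * Matrix.diagonal (fun a => (l a : ℂ)) * U.1

lemma unitaryConjDiagonal_apply_self (U : Matrix.unitaryGroup ι ℂ) (l : ι → ℝ) (k : ι) :
    unitaryConjDiagonal U l k k = weightedNormSq l (U.1.col k) := by
  rw [unitaryConjDiagonal, Matrix.mul_apply, weightedNormSq]
  push_cast
  refine Finset.sum_congr rfl fun a _ => ?_
  rw [Matrix.mul_diagonal, Matrix.conjTranspose_apply, mul_right_comm, ← starRingEnd_apply,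
    Complex.conj_mul', mul_comm, Matrix.col_apply]

lemma unitaryConjDiagonal_one (U : Matrix.unitaryGroup ι ℂ) : unitaryConjDiagonal U 1 = 1 := by
  simp only [unitaryConjDiagonal, Pi.one_apply, Complex.ofReal_one, Matrix.diagonal_one, mul_one]
  exact Matrix.mem_unitaryGroup_iff'.1 U.2

lemma weightedNormSq_one_unitary_col (U : Matrix.unitaryGroup ι ℂ) (k : ι) :
    weightedNormSq 1 (U.1.col k) = 1 := by
  have h := unitaryConjDiagonal_apply_self U 1 k
  rw [unitaryConjDiagonal_one, Matrix.one_apply_eq] at h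
  exact_mod_cast h.symm

lemma weightedNormSq_unitary_col_pos {D : ι → ℝ} (hD : ∀ a, 0 < D a)
    (U : Matrix.unitaryGroup ι ℂ) (k : ι) : 0 < weightedNormSq D (U.1.col k) :=
  weightedNormSq_pos hD fun h => by
    have h1 := weightedNormSq_one_unitary_col U k
    rw [h] at h1
    simp [weightedNormSq] at h1

lemma one_add_smul_unitaryConjDiagonal (δ : ℝ) (U : Matrix.unitaryGroup ι ℂ) (l : ι → ℝ) :
    1 + (δ : ℂ) • unitaryConjDiagonal U l = unitaryConjDiagonal U fun a => 1 + δ * l a := by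
  have hdiag : Matrix.diagonal (fun a => ((1 + δ * l a : ℝ) : ℂ)) =
      Matrix.diagonal (fun a => ((1 : ι → ℝ) a : ℂ)) +
        (δ : ℂ) • Matrix.diagonal fun a => (l a : ℂ) := by
    rw [← Matrix.diagonal_smul, Matrix.diagonal_add]
    simp
  rw [← unitaryConjDiagonal_one U]
  simp only [unitaryConjDiagonal, hdiag, mul_add, add_mul, Matrix.mul_smul, Matrix.smul_mul]

lemma unitaryConjDiagonal_mul (U : Matrix.unitaryGroup ι ℂ) (l m : ι → ℝ) :
    unitaryConjDiagonal U l * unitaryConjDiagonal U m = unitaryConjDiagonal U (l * m) := by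
  have hU : U.1 * U.1ᴴ = 1 := Matrix.mem_unitaryGroup_iff.1 U.2
  calc _ = U.1ᴴ * (Matrix.diagonal (fun a => (l a : ℂ)) * (U.1 * U.1ᴴ) *
        Matrix.diagonal fun a => (m a : ℂ)) * U.1 := by
        simp only [unitaryConjDiagonal, mul_assoc]
    _ = _ := by
        rw [hU, mul_one, Matrix.diagonal_mul_diagonal]
        simp only [unitaryConjDiagonal, Pi.mul_apply, Complex.ofReal_mul]

lemma inv_unitaryConjDiagonal (U : Matrix.unitaryGroup ι ℂ) {l : ι → ℝ} (hl : ∀ a, l a ≠ 0) :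
    (unitaryConjDiagonal U l)⁻¹ = unitaryConjDiagonal U l⁻¹ := by
  refine Matrix.inv_eq_right_inv ?_
  rw [unitaryConjDiagonal_mul, ← unitaryConjDiagonal_one U]
  congr 1
  exact funext fun a => mul_inv_cancel₀ (hl a)

lemma one_add_mul_weightedNormSq_unitary_col (s : ℝ) (D : ι → ℝ)
    (U : Matrix.unitaryGroup ι ℂ) (k : ι) :
    1 + s * weightedNormSq D (U.1.col k) = weightedNormSq (fun a => 1 + s * D a) (U.1.col k) := by
  have hone := weightedNormSq_one_unitary_col U k
  simp only [weightedNormSq, Pi.one_apply, one_mul] at hone ⊢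
  simp only [add_mul, one_mul, Finset.sum_add_distrib, hone, Finset.mul_sum, mul_assoc]

end unitaryConjDiagonal

lemma continuous_weightedNormSq_unitary_col (D : Fin n → ℝ) (k : Fin n) :
    Continuous fun U : Matrix.unitaryGroup (Fin n) ℂ => weightedNormSq D (U.1.col k) :=
  (continuous_weightedNormSq D).comp <|
    continuous_pi fun a => continuous_subtype_val.matrix_elem a k

lemma lintegral_inv_weightedNormSq_unitary_col_pow {D : Fin n → ℝ} (hD : ∀ a, 0 < D a)
    (k : Fin n) :
    ∫⁻ U : Matrix.unitaryGroup (Fin n) ℂ, ENNReal.ofReal ((weightedNormSq D (U.1.col k) ^ n)⁻¹)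
      ∂unitaryHaar n = ENNReal.ofReal (∏ a, (D a)⁻¹) := by
  have hpi : (0 : ℝ) < Real.pi ^ n := by positivity
  have hgauss := lintegral_unitaryHaar_norm_smul_col k
    (f := fun z => ENNReal.ofReal (Real.exp (-weightedNormSq D z)))
    ((continuous_weightedNormSq D).measurable.neg.exp.ennreal_ofReal)
  have hinner (U : Matrix.unitaryGroup (Fin n) ℂ) :
      ∫⁻ z : Fin n → ℂ, ENNReal.ofReal
        (Real.exp (-weightedNormSq D ((‖WithLp.toLp 2 z‖ : ℂ) • U.1.col k))) =
      ENNReal.ofReal (Real.pi ^ n) * ENNReal.ofReal ((weightedNormSq D (U.1.col k) ^ n)⁻¹) := by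
    simp only [weightedNormSq_norm_smul]
    rw [lintegral_exp_neg_weightedNormSq fun _ => weightedNormSq_unitary_col_pos hD U k,
      ← ENNReal.ofReal_mul hpi.le]
    simp [div_eq_mul_inv, mul_pow]
  have houter : ∏ a, Real.pi / D a = Real.pi ^ n * ∏ a, (D a)⁻¹ := by
    simp [div_eq_mul_inv, Finset.prod_mul_distrib]
  simp only [hinner] at hgauss
  rw [lintegral_const_mul' _ _ ENNReal.ofReal_ne_top, lintegral_exp_neg_weightedNormSq hD, houter,
    ENNReal.ofReal_mul hpi.le] at hgauss
  exact (ENNReal.mul_right_inj (ENNReal.ofReal_pos.2 hpi).ne' ENNReal.ofReal_ne_top).1 hgauss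

theorem integral_inv_weightedNormSq_unitary_col_pow {D : Fin n → ℝ} (hD : ∀ a, 0 < D a)
    (k : Fin n) :
    ∫ U : Matrix.unitaryGroup (Fin n) ℂ, (weightedNormSq D (U.1.col k) ^ n)⁻¹ ∂unitaryHaar n =
      ∏ a, (D a)⁻¹ := by
  rw [integral_eq_lintegral_of_nonneg_ae, lintegral_inv_weightedNormSq_unitary_col_pow hD,
    ENNReal.toReal_ofReal (Finset.prod_nonneg fun a _ => (inv_pos.2 (hD a)).le)]
  · exact ae_of_all _ fun U =>
      inv_nonneg.2 (pow_nonneg (weightedNormSq_unitary_col_pos hD U k).le _)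
  · exact ((continuous_weightedNormSq_unitary_col D k).measurable.pow_const
      n).inv.aestronglyMeasurable

end UnitaryHaar

/-! ### The SINR of a matrix with unitarily invariant Gram matrix -/

section Receiver

variable {n : ℕ}

/-- The output SINR `mmseSINR δ H k` as a function of the Gram matrix `G = Hᴴ H`. -/
noncomputable def gramSINR (δ : ℝ) (G : Matrix (Fin n) (Fin n) ℂ) (k : Fin n) : ℝ :=
  1 / ((1 + (δ : ℂ) • G : Matrix (Fin n) (Fin n) ℂ)⁻¹ k k).re - 1

lemma measurable_gramSINR (δ : ℝ) (k : Fin n) : Measurable fun G => gramSINR δ G k := by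
  have h1 : Continuous fun G : Matrix (Fin n) (Fin n) ℂ => 1 + (δ : ℂ) • G := by fun_prop
  have h2 : Measurable fun G : Matrix (Fin n) (Fin n) ℂ => (1 + (δ : ℂ) • G)⁻¹ k k := by
    simp only [Matrix.inv_def, Ring.inverse_eq_inv', Matrix.smul_apply, smul_eq_mul]
    exact h1.matrix_det.measurable.inv.mul (h1.matrix_adjugate.matrix_elem k k).measurable
  exact ((Complex.measurable_re.comp h2).const_div 1).sub_const 1

lemma continuous_unitaryConjDiagonal :
    Continuous fun Ul : Matrix.unitaryGroup (Fin n) ℂ × (Fin n → ℝ) =>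
      unitaryConjDiagonal Ul.1 Ul.2 := by
  have hU : Continuous fun Ul : Matrix.unitaryGroup (Fin n) ℂ × (Fin n → ℝ) => Ul.1.1 :=
    continuous_subtype_val.comp continuous_fst
  exact (hU.matrix_conjTranspose.mul (Continuous.matrix_diagonal (by fun_prop))).mul hU

lemma measurable_gramSINR_unitaryConjDiagonal (δ : ℝ) (k : Fin n) :
    Measurable fun Ul : Matrix.unitaryGroup (Fin n) ℂ × (Fin n → ℝ) =>
      gramSINR δ (unitaryConjDiagonal Ul.1 Ul.2) k :=
  (measurable_gramSINR δ k).comp continuous_unitaryConjDiagonal.measurable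

variable {δ : ℝ} {l : Fin n → ℝ}

lemma inv_one_add_gramSINR_unitaryConjDiagonal (hδl : ∀ a, 1 + δ * l a ≠ 0)
    (U : Matrix.unitaryGroup (Fin n) ℂ) (k : Fin n) :
    (1 + gramSINR δ (unitaryConjDiagonal U l) k)⁻¹ =
      weightedNormSq (fun a => (1 + δ * l a)⁻¹) (U.1.col k) := by
  rw [gramSINR, one_add_smul_unitaryConjDiagonal, inv_unitaryConjDiagonal U hδl,
    unitaryConjDiagonal_apply_self, Complex.ofReal_re, add_sub_cancel, one_div, inv_inv]
  rfl

lemma gramSINR_unitaryConjDiagonal_pos (hδl : ∀ a, 0 < δ * l a) (U : Matrix.unitaryGroup (Fin n) ℂ)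
    (k : Fin n) : 0 < gramSINR δ (unitaryConjDiagonal U l) k := by
  have h1 (a : Fin n) : 1 < 1 + δ * l a := lt_add_of_pos_right 1 (hδl a)
  have hinv :=
    inv_one_add_gramSINR_unitaryConjDiagonal (fun a => (zero_lt_one.trans (h1 a)).ne') U k
  have hpos := weightedNormSq_unitary_col_pos (fun a => inv_pos.2 (zero_lt_one.trans (h1 a))) U k
  have hlt := weightedNormSq_unitary_col_pos (D := fun a => 1 + (-1) * (1 + δ * l a)⁻¹)
    (fun a => by linarith [inv_lt_one_of_one_lt₀ (h1 a)]) U k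
  rw [← one_add_mul_weightedNormSq_unitary_col, ← hinv] at hlt
  rw [← hinv, inv_pos] at hpos
  linarith [(inv_lt_one₀ hpos).1 (by linarith)]

theorem integral_gramSINR_unitaryConjDiagonal (hδl : ∀ a, 0 < δ * l a) (k : Fin n) {s : ℝ}
    (hs : -1 < s) :
    ∫ U, ((1 + s * (1 + gramSINR δ (unitaryConjDiagonal U l) k)⁻¹) ^ n)⁻¹ ∂unitaryHaar n =
      ∏ a, (1 + s * (1 + δ * l a)⁻¹)⁻¹ := by
  simp only [inv_one_add_gramSINR_unitaryConjDiagonal fun a => (add_pos one_pos (hδl a)).ne',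
    one_add_mul_weightedNormSq_unitary_col]
  exact integral_inv_weightedNormSq_unitary_col_pow
    (fun a => one_add_mul_inv_pos hs (le_add_of_nonneg_right (hδl a).le)) k

end Receiver

/-! ### Lagrange interpolation and the Andréief identity -/

section Lagrange

variable {F ι : Type*} [Field F] [DecidableEq ι]

lemma sub_mul_eval_lagrangeBasis {s : Finset ι} (x : ι → F) {a : ι} (ha : a ∈ s) (u : F) :
    (u - x a) * (Lagrange.basis s x a).eval u =
      (Lagrange.nodal s x).eval u * Lagrange.nodalWeight s x a := by
  rcases eq_or_ne u (x a) with rfl | hu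
  · rw [sub_self, zero_mul, Lagrange.eval_nodal_at_node ha, zero_mul]
  · have : u - x a ≠ 0 := sub_ne_zero.2 hu
    rw [Lagrange.eval_basis_not_at_node ha hu]
    field_simp

lemma sum_sub_div_sub_mul_eval_lagrangeBasis {s : Finset ι} (hs : s.Nonempty) {x : ι → F}
    (hx : InjOn x s) (u : F) {v : F} (hv : ∀ a ∈ s, v ≠ x a) :
    ∑ a ∈ s, (u - x a) / (v - x a) * (Lagrange.basis s x a).eval u =
      ∏ a ∈ s, (u - x a) / (v - x a) := by
  have hone := Lagrange.eval_interpolate_not_at_node (1 : ι → F) hv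
  rw [Lagrange.interpolate_one hx hs, Polynomial.eval_one] at hone
  calc _ = (Lagrange.nodal s x).eval u *
        ∑ a ∈ s, Lagrange.nodalWeight s x a * (v - x a)⁻¹ * (1 : ι → F) a := by
        rw [Finset.mul_sum]
        refine Finset.sum_congr rfl fun a ha => ?_
        rw [div_mul_eq_mul_div, sub_mul_eval_lagrangeBasis x ha, Pi.one_apply, mul_one,
          ← mul_assoc, div_eq_mul_inv]
    _ = (Lagrange.nodal s x).eval u / (Lagrange.nodal s x).eval v := by
        rw [eq_div_iff (Lagrange.eval_nodal_not_at_node hv), mul_assoc,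
          mul_comm (Finset.sum _ _), ← hone, mul_one]
    _ = _ := by rw [Lagrange.eval_nodal, Lagrange.eval_nodal, Finset.prod_div_distrib]

variable [Fintype ι]

lemma det_updateRow_eval_eq_eval_lagrangeBasis_mul {p : ι → Polynomial F}
    (hp : ∀ j, (p j).degree < Fintype.card ι) {x : ι → F} (hx : Function.Injective x) (u : F)
    (a : ι) :
    ((Matrix.of fun i j => (p j).eval (x i)).updateRow a fun j => (p j).eval u).det =
      (Lagrange.basis Finset.univ x a).eval u * (Matrix.of fun i j => (p j).eval (x i)).det := by
  have hrow : (fun j => (p j).eval u) = ∑ b, (Lagrange.basis Finset.univ x b).eval u •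
      (Matrix.of fun i j => (p j).eval (x i)) b := by
    ext j
    conv_lhs => rw [Lagrange.eq_interpolate (s := Finset.univ) hx.injOn (hp j)]
    simp only [Lagrange.interpolate_apply, Polynomial.eval_finsetSum, Polynomial.eval_mul,
      Polynomial.eval_C, Finset.sum_apply, Pi.smul_apply, Matrix.of_apply, smul_eq_mul, mul_comm]
  rw [hrow, Matrix.det_updateRow_sum, smul_eq_mul]

lemma det_eval_mul_prod_sub_div_sub [Nonempty ι] {p : ι → Polynomial F}
    (hp : ∀ j, (p j).degree < Fintype.card ι) {x : ι → F} (hx : Function.Injective x) (u : F)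
    {v : F} (hv : ∀ a, v ≠ x a) :
    (Matrix.of fun i j => (p j).eval (x i)).det * ∏ a, (u - x a) / (v - x a) =
      ∑ a, (u - x a) / (v - x a) *
        ((Matrix.of fun i j => (p j).eval (x i)).updateRow a fun j => (p j).eval u).det := by
  simp only [det_updateRow_eval_eq_eval_lagrangeBasis_mul hp hx]
  rw [← sum_sub_div_sub_mul_eval_lagrangeBasis Finset.univ_nonempty hx.injOn u fun a _ => hv a,
    mul_comm, Finset.sum_mul]
  simp only [mul_assoc]

end Lagrange

section Andreief

variable {𝕜 ι α : Type*} [RCLike 𝕜] [DecidableEq ι]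

lemma perm_eq_of_forall_ne {β : Type*} {σ τ : Equiv.Perm β} {a : β}
    (h : ∀ i, i ≠ a → σ i = τ i) : σ = τ := by
  refine Equiv.ext fun i => ?_
  rcases eq_or_ne i a with rfl | hi
  · obtain ⟨j, hj⟩ := τ.surjective (σ i)
    rcases eq_or_ne j i with rfl | hji
    · exact hj.symm
    · exact absurd (σ.injective ((h j hji).trans hj)) hji
  · exact h i hi

lemma integrable_update_mul {P Q : ι → α → 𝕜} {G : α → 𝕜} [MeasurableSpace α] {μ : Measure α}
    (hPQ : ∀ b c, Integrable (fun x => P b x * Q c x) μ)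
    (hG : ∀ j, Integrable (fun x => G x * Q j x) μ) (a : ι) (c : ι → 𝕜) (i b d : ι) :
    Integrable (fun x => Function.update (fun _ : ι => P) a (fun j y => G y * c j) i b x * Q d x)
      μ := by
  rcases eq_or_ne i a with rfl | hi
  · simp only [Function.update_self]
    exact ((hG d).const_mul (c b)).congr (ae_of_all _ fun x => by ring)
  · simpa only [Function.update_of_ne hi] using hPQ b d

variable [Fintype ι]

lemma mul_det_updateRow_eq_det_update (P : ι → α → 𝕜) (G : α → 𝕜) (a : ι) (c : ι → 𝕜) (x : ι → α) :
    G (x a) * ((Matrix.of fun i j => P j (x i)).updateRow a c).det =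
      (Matrix.of fun i j =>
        Function.update (fun _ : ι => P) a (fun j y => G y * c j) i j (x i)).det := by
  rw [← Matrix.det_updateRow_smul]
  congr 1
  ext i j
  rcases eq_or_ne i a with rfl | hi
  · simp only [Matrix.updateRow_self, Pi.smul_apply, smul_eq_mul, Matrix.of_apply,
      Function.update_self]
  · simp only [Matrix.updateRow_ne hi, Matrix.of_apply, Function.update_of_ne hi]

lemma det_of_mul_det_of_eq_sum {R : Type*} [CommRing R] (A B : Matrix ι ι R) :
    A.det * B.det = ∑ σ : Equiv.Perm ι, ∑ τ : Equiv.Perm ι,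
      ((Equiv.Perm.sign σ * Equiv.Perm.sign τ : ℤ) : R) * ∏ i, A i (σ i) * B i (τ i) := by
  rw [← A.det_transpose, ← B.det_transpose, Matrix.det_apply', Matrix.det_apply',
    Finset.sum_mul_sum]
  refine Finset.sum_congr rfl fun σ _ => Finset.sum_congr rfl fun τ _ => ?_
  simp only [Matrix.transpose_apply, Finset.prod_mul_distrib]
  push_cast
  ring

variable [MeasurableSpace α] {μ : Measure α} [SigmaFinite μ]

lemma integrable_det_mul_det {f g : ι → ι → α → 𝕜}
    (hfg : ∀ i a b, Integrable (fun x => f i a x * g i b x) μ) :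
    Integrable (fun x : ι → α => (Matrix.of fun i j => f i j (x i)).det *
      (Matrix.of fun i j => g i j (x i)).det) (Measure.pi fun _ => μ) := by
  simp only [det_of_mul_det_of_eq_sum, Matrix.of_apply]
  exact integrable_finsetSum _ fun σ _ => integrable_finsetSum _ fun τ _ =>
    (Integrable.fintype_prod fun i => hfg i (σ i) (τ i)).const_mul _

theorem integral_det_mul_det {f g : ι → ι → α → 𝕜}
    (hfg : ∀ i a b, Integrable (fun x => f i a x * g i b x) μ) :
    ∫ x : ι → α, (Matrix.of fun i j => f i j (x i)).det * (Matrix.of fun i j => g i j (x i)).det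
        ∂(Measure.pi fun _ => μ) =
      ∑ σ : Equiv.Perm ι, ∑ τ : Equiv.Perm ι,
        ((Equiv.Perm.sign σ * Equiv.Perm.sign τ : ℤ) : 𝕜) *
          ∏ i, ∫ x, f i (σ i) x * g i (τ i) x ∂μ := by
  have hint (σ τ : Equiv.Perm ι) : Integrable (fun x : ι → α =>
      ((Equiv.Perm.sign σ * Equiv.Perm.sign τ : ℤ) : 𝕜) *
        ∏ i, f i (σ i) (x i) * g i (τ i) (x i)) (Measure.pi fun _ => μ) :=
    (Integrable.fintype_prod fun i => hfg i (σ i) (τ i)).const_mul _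
  simp only [det_of_mul_det_of_eq_sum, Matrix.of_apply]
  rw [integral_finsetSum _ fun _ _ => integrable_finsetSum _ fun _ _ => hint _ _]
  refine Finset.sum_congr rfl fun σ _ => ?_
  rw [integral_finsetSum _ fun τ _ => hint σ τ]
  refine Finset.sum_congr rfl fun τ _ => ?_
  rw [integral_const_mul,
    integral_fintype_prod_eq_prod (f := fun i y => f i (σ i) y * g i (τ i) y)]

lemma integral_det_mul_det_of_biorthonormal_off {f g : ι → ι → α → 𝕜} {a : ι}
    (hfg : ∀ i b c, Integrable (fun x => f i b x * g i c x) μ)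
    (h : ∀ i, i ≠ a → ∀ b c, ∫ x, f i b x * g i c x ∂μ = if b = c then 1 else 0) :
    ∫ x : ι → α, (Matrix.of fun i j => f i j (x i)).det * (Matrix.of fun i j => g i j (x i)).det
        ∂(Measure.pi fun _ => μ) =
      ∑ σ : Equiv.Perm ι, ∫ x, f a (σ a) x * g a (σ a) x ∂μ := by
  rw [integral_det_mul_det hfg]
  refine Finset.sum_congr rfl fun σ _ => ?_
  -- a permutation is determined by its values off `a`, so only `τ = σ` survives
  rw [Finset.sum_eq_single σ _ fun hσ => absurd (Finset.mem_univ σ) hσ]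
  · rw [Int.units_coe_mul_self, Int.cast_one, one_mul, Finset.prod_eq_single a _ fun ha =>
      absurd (Finset.mem_univ a) ha]
    exact fun i _ hi => by rw [h i hi, if_pos rfl]
  · intro τ _ hτ
    obtain ⟨i, hia, hi⟩ : ∃ i, i ≠ a ∧ σ i ≠ τ i := by
      by_contra! hc
      exact hτ (perm_eq_of_forall_ne hc).symm
    rw [Finset.prod_eq_zero (Finset.mem_univ i) (by rw [h i hia, if_neg hi]), mul_zero]

theorem integral_sum_mul_det_updateRow_mul_det {P Q : ι → α → 𝕜} {G : α → 𝕜}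
    (hPQ : ∀ b c, Integrable (fun x => P b x * Q c x) μ)
    (h : ∀ b c, ∫ x, P b x * Q c x ∂μ = if b = c then 1 else 0)
    (hG : ∀ j, Integrable (fun x => G x * Q j x) μ) (c : ι → 𝕜) :
    ∫ x : ι → α, ∑ a, G (x a) * ((Matrix.of fun i j => P j (x i)).updateRow a c).det *
        (Matrix.of fun i j => Q j (x i)).det ∂(Measure.pi fun _ => μ) =
      (Fintype.card ι).factorial * ∑ j, c j * ∫ x, G x * Q j x ∂μ := by
  have hint := integrable_update_mul hPQ hG
  simp only [mul_det_updateRow_eq_det_update]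
  rw [integral_finsetSum _ fun a _ => integrable_det_mul_det (g := fun _ => Q) (hint a c)]
  calc _ = ∑ a, ∑ σ : Equiv.Perm ι, c (σ a) * ∫ x, G x * Q (σ a) x ∂μ := by
        refine Finset.sum_congr rfl fun a _ => ?_
        rw [integral_det_mul_det_of_biorthonormal_off (a := a) (g := fun _ => Q) (hint a c)
          fun i hi b d => by simpa only [Function.update_of_ne hi] using h b d]
        simp only [Function.update_self, mul_right_comm (G _), integral_mul_const,
          mul_comm (c _)]
    _ = ∑ _σ : Equiv.Perm ι, ∑ j, c j * ∫ x, G x * Q j x ∂μ := by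
        rw [Finset.sum_comm]
        exact Finset.sum_congr rfl fun σ _ =>
          Equiv.sum_comp σ fun j => c j * ∫ x, G x * Q j x ∂μ
    _ = _ := by
        rw [Finset.sum_const, Finset.card_univ, Fintype.card_perm, nsmul_eq_mul]

end Andreief

/-! ### Polynomial ensembles -/

section Ensemble

variable {n : ℕ} {p : Fin n → Polynomial ℝ} {q : Fin n → ℝ → ℝ}

namespace IsBiorthonormalSystem

lemma degree_lt (h : IsBiorthonormalSystem p q) (j : Fin n) :
    (p j).degree < Fintype.card (Fin n) := by
  rw [Fintype.card_fin, Polynomial.degree_eq_natDegree (h.monic j).ne_zero, h.natDegree_eq]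
  exact_mod_cast j.2

lemma eq_one (h : IsBiorthonormalSystem p q) (hn : 0 < n) : p ⟨0, hn⟩ = 1 :=
  Polynomial.eq_one_of_monic_natDegree_zero (h.monic _) (h.natDegree_eq _)

lemma integrableOn_weight (h : IsBiorthonormalSystem p q) (j : Fin n) :
    IntegrableOn (q j) (Ioi 0) := by
  simpa only [h.eq_one j.pos, Polynomial.eval_one, one_mul] using h.integrable ⟨0, j.pos⟩ j

lemma integrableOn_id_mul_weight (h : IsBiorthonormalSystem p q) (hn : 2 ≤ n) (j : Fin n) :
    IntegrableOn (fun y => y * q j y) (Ioi 0) := by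
  have hp1 := (h.monic ⟨1, hn⟩).eq_X_add_C (h.natDegree_eq _)
  have hint := h.integrable ⟨1, hn⟩ j
  set c := (p ⟨1, hn⟩).coeff 0
  rw [hp1] at hint
  refine (hint.sub ((h.integrableOn_weight j).const_mul c)).congr (ae_of_all _ fun y => ?_)
  simp only [Pi.sub_apply, Polynomial.eval_add, Polynomial.eval_X, Polynomial.eval_C]
  ring

lemma integrableOn_log_mul_weight (h : IsBiorthonormalSystem p q) (hn : 2 ≤ n) {δ : ℝ}
    (hδ : 0 ≤ δ) (j : Fin n) : IntegrableOn (fun y => Real.log (1 + δ * y) * q j y) (Ioi 0) := by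
  refine ((h.integrableOn_id_mul_weight hn j).const_mul δ).mono
    ((Measurable.aestronglyMeasurable (by fun_prop)).mul
      (h.integrableOn_weight j).aestronglyMeasurable) ?_
  filter_upwards [ae_restrict_mem measurableSet_Ioi] with y hy
  have hδy : 0 ≤ δ * y := mul_nonneg hδ (mem_Ioi.1 hy).le
  rw [← mul_assoc, norm_mul, norm_mul (δ * y), Real.norm_of_nonneg hδy,
    Real.norm_of_nonneg (Real.log_nonneg (by linarith))]
  gcongr
  linarith [Real.log_le_sub_one_of_pos (show 0 < 1 + δ * y by linarith)]

lemma integrableOn_sub_div_sub_mul_weight (h : IsBiorthonormalSystem p q) (u : ℝ) {v : ℝ}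
    (hv : v < 0) (j : Fin n) : IntegrableOn (fun y => (u - y) / (v - y) * q j y) (Ioi 0) := by
  refine (h.integrableOn_weight j).bdd_mul (c := 1 + |u - v| / -v)
    (Measurable.aestronglyMeasurable (by fun_prop)) ?_
  filter_upwards [ae_restrict_mem measurableSet_Ioi] with y hy
  have hy0 : 0 < y := hy
  have hvy : v - y ≠ 0 := by linarith
  calc ‖(u - y) / (v - y)‖ = ‖1 + (u - v) / (v - y)‖ := by
        congr 1
        field_simp
        ring
    _ ≤ ‖(1 : ℝ)‖ + ‖(u - v) / (v - y)‖ := norm_add_le _ _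
    _ ≤ 1 + |u - v| / -v := by
        rw [norm_one, norm_div, Real.norm_eq_abs, Real.norm_of_nonpos (by linarith)]
        gcongr <;> linarith

lemma aemeasurable_polynomialEnsembleDensity (h : IsBiorthonormalSystem p q) :
    AEMeasurable (polynomialEnsembleDensity q)
      (Measure.pi fun _ : Fin n => (volume : Measure ℝ).restrict (Ioi 0)) := by
  have hq (i j : Fin n) : AEMeasurable (fun l : Fin n → ℝ => q j (l i))
      (Measure.pi fun _ : Fin n => (volume : Measure ℝ).restrict (Ioi 0)) :=
    (h.integrableOn_weight j).aemeasurable.comp_quasiMeasurePreserving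
      (Measure.quasiMeasurePreserving_eval _ i)
  unfold polynomialEnsembleDensity
  simp_rw [Matrix.det_apply']
  refine AEMeasurable.mul (Measurable.aemeasurable (by fun_prop)) ?_
  exact Finset.aemeasurable_fun_sum _ fun σ _ =>
    (Finset.aemeasurable_fun_prod _ fun i _ => hq (σ i) i).const_mul _

lemma polynomialEnsembleDensity_eq (h : IsBiorthonormalSystem p q) (l : Fin n → ℝ) :
    polynomialEnsembleDensity q l = 1 / (n.factorial : ℝ) *
      (Matrix.of fun i j => (p j).eval (l i)).det * (Matrix.of fun i j => q j (l i)).det := by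
  rw [polynomialEnsembleDensity, ← Matrix.det_eval_matrixOfPolynomials_eq_det_vandermonde l p
    h.natDegree_eq h.monic, Matrix.det_vandermonde]
  congr 2
  exact Finset.prod_comm' fun k j => by simp only [Finset.mem_univ, Finset.mem_Iio,
    Finset.mem_Ioi, true_and, and_true]

lemma polynomialEnsembleDensity_mul_prod (h : IsBiorthonormalSystem p q) (hn : 0 < n)
    {l : Fin n → ℝ} (u : ℝ) {v : ℝ} (hv : ∀ a, v ≠ l a) :
    polynomialEnsembleDensity q l * ∏ a, (u - l a) / (v - l a) = 1 / (n.factorial : ℝ) *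
      ∑ a, (u - l a) / (v - l a) *
        ((Matrix.of fun i j => (p j).eval (l i)).updateRow a fun j => (p j).eval u).det *
          (Matrix.of fun i j => q j (l i)).det := by
  rw [h.polynomialEnsembleDensity_eq]
  by_cases hl : Function.Injective l
  · have : Nonempty (Fin n) := ⟨⟨0, hn⟩⟩
    rw [← Finset.sum_mul, ← det_eval_mul_prod_sub_div_sub h.degree_lt hl u hv]
    ring
  · obtain ⟨a, b, hab, hne⟩ := Function.not_injective_iff.1 hl
    have hdet : (Matrix.of fun i j => q j (l i)).det = 0 :=
      Matrix.det_zero_of_row_eq hne (funext fun j => congrArg (q j) hab)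
    simp only [hdet, mul_zero, zero_mul, Finset.sum_const_zero]

end IsBiorthonormalSystem

lemma polynomialEnsembleKernel_mul_eq_sum (f : ℝ → ℝ) (u y : ℝ) :
    polynomialEnsembleKernel p q u y * f y = ∑ j, (p j).eval u * (f y * q j y) := by
  rw [polynomialEnsembleKernel, Finset.sum_mul]
  exact Finset.sum_congr rfl fun j _ => by ring

lemma integrableOn_polynomialEnsembleKernel_mul {f : ℝ → ℝ} (u : ℝ)
    (hf : ∀ j, IntegrableOn (fun y => f y * q j y) (Ioi 0)) :
    IntegrableOn (fun y => polynomialEnsembleKernel p q u y * f y) (Ioi 0) := by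
  simp only [polynomialEnsembleKernel_mul_eq_sum]
  exact integrable_finsetSum _ fun j _ => (hf j).const_mul _

lemma setIntegral_polynomialEnsembleKernel_mul {f : ℝ → ℝ} (u : ℝ)
    (hf : ∀ j, IntegrableOn (fun y => f y * q j y) (Ioi 0)) :
    ∫ y in Ioi (0 : ℝ), polynomialEnsembleKernel p q u y * f y =
      ∑ j, (p j).eval u * ∫ y in Ioi (0 : ℝ), f y * q j y := by
  simp only [polynomialEnsembleKernel_mul_eq_sum]
  rw [integral_finsetSum _ fun j _ => (hf j).const_mul _]
  simp only [integral_const_mul]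

lemma volume_restrict_pi_Ioi : (volume : Measure (Fin n → ℝ)).restrict
    (univ.pi fun _ => Ioi 0) = Measure.pi fun _ => volume.restrict (Ioi 0) := by
  rw [volume_pi, Measure.restrict_pi_pi]

namespace IsBiorthonormalSystem

lemma integrableOn_polynomialEnsembleKernel (h : IsBiorthonormalSystem p q) (u : ℝ) :
    IntegrableOn (polynomialEnsembleKernel p q u) (Ioi 0) := by
  simpa only [mul_one] using integrableOn_polynomialEnsembleKernel_mul (p := p) (f := fun _ => 1) u
    (by simpa only [one_mul] using h.integrableOn_weight)

lemma integral_polynomialEnsembleKernel (h : IsBiorthonormalSystem p q) (hn : 0 < n) (u : ℝ) :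
    ∫ y in Ioi (0 : ℝ), polynomialEnsembleKernel p q u y = 1 := by
  have hsum := setIntegral_polynomialEnsembleKernel_mul (p := p) (q := q)
    (f := (p ⟨0, hn⟩).eval) u (h.integrable _)
  simp only [h.biorthonormal] at hsum
  simpa only [h.eq_one hn, Polynomial.eval_one, mul_one, mul_ite, mul_zero, Finset.sum_ite_eq,
    Finset.mem_univ, if_true] using hsum

lemma integrableOn_log_mul_polynomialEnsembleKernel (h : IsBiorthonormalSystem p q) (hn : 2 ≤ n)
    {δ : ℝ} (hδ : 0 ≤ δ) (u : ℝ) :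
    IntegrableOn (fun y => Real.log (1 + δ * y) * polynomialEnsembleKernel p q u y) (Ioi 0) := by
  simpa only [mul_comm (Real.log _)] using
    integrableOn_polynomialEnsembleKernel_mul u (h.integrableOn_log_mul_weight hn hδ)

theorem setIntegral_polynomialEnsembleDensity_mul_prod_sub_div_sub
    (h : IsBiorthonormalSystem p q) (hn : 0 < n) (u : ℝ) {v : ℝ} (hv : v < 0) :
    ∫ l in univ.pi fun _ : Fin n => Ioi (0 : ℝ),
        polynomialEnsembleDensity q l * ∏ a, (u - l a) / (v - l a) =
      ∫ y in Ioi (0 : ℝ), polynomialEnsembleKernel p q u y * ((u - y) / (v - y)) := by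
  have hG := h.integrableOn_sub_div_sub_mul_weight u hv
  have hfac : (n.factorial : ℝ) ≠ 0 := Nat.cast_ne_zero.2 n.factorial_ne_zero
  rw [setIntegral_congr_fun (MeasurableSet.univ_pi fun _ => measurableSet_Ioi) fun l hl =>
      h.polynomialEnsembleDensity_mul_prod hn u fun a => (hv.trans (hl a (mem_univ a))).ne,
    integral_const_mul, volume_restrict_pi_Ioi,
    integral_sum_mul_det_updateRow_mul_det h.integrable h.biorthonormal hG,
    setIntegral_polynomialEnsembleKernel_mul u hG, Fintype.card_fin, ← mul_assoc,
    one_div_mul_cancel hfac, one_mul]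

end IsBiorthonormalSystem

lemma neg_one_div_sub_div_neg_one_add_div_sub {δ y s : ℝ} (hδ : δ ≠ 0) (hy : 1 + δ * y ≠ 0) :
    (-1 / δ - y) / (-(1 + s) / δ - y) = (1 + s * (1 + δ * y)⁻¹)⁻¹ := by
  have h1 : -1 / δ - y = -(1 + δ * y) / δ := by field_simp; ring
  have h2 : -(1 + s) / δ - y = -(1 + δ * y) * (1 + s * (1 + δ * y)⁻¹) / δ := by field_simp; ring
  rw [h1, h2, div_div_div_cancel_right₀ hδ, div_mul_cancel_left₀ (neg_ne_zero.2 hy)]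

/-- The joint law of the eigenvalues `λ₁, …, λₙ`, with density `polynomialEnsembleDensity q` on
`(0, ∞)ⁿ`. -/
noncomputable def polynomialEnsembleLaw (q : Fin n → ℝ → ℝ) : Measure (Fin n → ℝ) :=
  (volume.restrict (univ.pi fun _ : Fin n => Ioi (0 : ℝ))).withDensity
    fun l => ENNReal.ofReal (polynomialEnsembleDensity q l)

instance : SFinite (polynomialEnsembleLaw q) := by
  unfold polynomialEnsembleLaw
  infer_instance

lemma ae_polynomialEnsembleLaw_pos : ∀ᵐ l ∂polynomialEnsembleLaw q, ∀ a, 0 < l a := by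
  refine (withDensity_absolutelyContinuous _ _).ae_le ?_
  filter_upwards [ae_restrict_mem (MeasurableSet.univ_pi fun _ => measurableSet_Ioi)] with l hl a
    using hl a (mem_univ a)

namespace IsBiorthonormalSystem

variable {δ s : ℝ}

lemma integrableOn_polynomialEnsembleKernel_mul_inv (h : IsBiorthonormalSystem p q) (hδ : 0 < δ)
    (hs : -1 < s) :
    IntegrableOn (fun y => polynomialEnsembleKernel p q (-1 / δ) y * (1 + s * (1 + δ * y)⁻¹)⁻¹)
      (Ioi 0) := by
  have hv : -(1 + s) / δ < 0 := div_neg_of_neg_of_pos (by linarith) hδ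
  refine (integrableOn_polynomialEnsembleKernel_mul (p := p) (-1 / δ)
    (h.integrableOn_sub_div_sub_mul_weight (-1 / δ) hv)).congr_fun (fun y hy => ?_)
    measurableSet_Ioi
  have hy0 : 0 < y := hy
  simp only [neg_one_div_sub_div_neg_one_add_div_sub hδ.ne' (by positivity : 1 + δ * y ≠ 0)]

theorem integral_prod_inv_polynomialEnsembleLaw (h : IsBiorthonormalSystem p q) (hn : 0 < n)
    (hq : ∀ᵐ l ∂(volume.restrict (univ.pi fun _ : Fin n => Ioi (0 : ℝ))),
      0 ≤ polynomialEnsembleDensity q l) (hδ : 0 < δ) (hs : -1 < s) :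
    ∫ l, ∏ a, (1 + s * (1 + δ * l a)⁻¹)⁻¹ ∂polynomialEnsembleLaw q =
      ∫ y in Ioi (0 : ℝ),
        polynomialEnsembleKernel p q (-1 / δ) y * (1 + s * (1 + δ * y)⁻¹)⁻¹ := by
  have hv : -(1 + s) / δ < 0 := div_neg_of_neg_of_pos (by linarith) hδ
  have hfactor {y : ℝ} (hy : 0 < y) : (-1 / δ - y) / (-(1 + s) / δ - y) =
      (1 + s * (1 + δ * y)⁻¹)⁻¹ :=
    neg_one_div_sub_div_neg_one_add_div_sub hδ.ne' (by positivity)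
  have hmeas := h.aemeasurable_polynomialEnsembleDensity
  rw [← volume_restrict_pi_Ioi] at hmeas
  rw [polynomialEnsembleLaw, integral_withDensity_ofReal hmeas hq,
    ← setIntegral_congr_fun measurableSet_Ioi fun y hy =>
      congrArg (polynomialEnsembleKernel p q (-1 / δ) y * ·) (hfactor hy),
    ← h.setIntegral_polynomialEnsembleDensity_mul_prod_sub_div_sub hn _ hv]
  refine setIntegral_congr_fun (MeasurableSet.univ_pi fun _ => measurableSet_Ioi) fun l hl => ?_
  simp only [hfactor (hl _ (mem_univ _))]

end IsBiorthonormalSystem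

end Ensemble

/-! ### The law of the output SINR -/

lemma logDeriv_Gamma_natCast {n : ℕ} (hn : 0 < n) :
    logDeriv Real.Gamma n = -Real.eulerMascheroniConstant + harmonic (n - 1) := by
  obtain ⟨m, rfl⟩ := Nat.exists_eq_add_of_le' hn
  have hm : (m.factorial : ℝ) ≠ 0 := Nat.cast_ne_zero.2 m.factorial_ne_zero
  rw [logDeriv_apply, Nat.cast_succ, Real.deriv_Gamma_nat, Real.Gamma_nat_eq_factorial,
    mul_div_cancel_left₀ _ hm, Nat.add_sub_cancel]

namespace IsInvariantPolynomialEnsemble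

variable {Ω : Type*} [MeasurableSpace Ω] {P : Measure Ω} {nr nt : ℕ}
  {H : Ω → Matrix (Fin nr) (Fin nt) ℂ} {p : Fin nt → Polynomial ℝ} {q : Fin nt → ℝ → ℝ} {δ : ℝ}

lemma aemeasurable_gram (hH : IsInvariantPolynomialEnsemble P H p q) :
    AEMeasurable (fun ω => (H ω)ᴴ * H ω) P := by
  have hgram : Continuous fun M : Matrix (Fin nr) (Fin nt) ℂ => Mᴴ * M :=
    continuous_id.matrix_conjTranspose.matrix_mul continuous_id
  exact hgram.measurable.comp_aemeasurable hH.aemeasurable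

lemma aemeasurable_mmseSINR (hH : IsInvariantPolynomialEnsemble P H p q) (δ : ℝ) (k : Fin nt) :
    AEMeasurable (fun ω => mmseSINR δ (H ω) k) P :=
  (measurable_gramSINR δ k).comp_aemeasurable hH.aemeasurable_gram

lemma map_gram_eq (hH : IsInvariantPolynomialEnsemble P H p q) :
    P.map (fun ω => (H ω)ᴴ * H ω) = ((unitaryHaar nt).prod (polynomialEnsembleLaw q)).map
      fun Ul => unitaryConjDiagonal Ul.1 Ul.2 :=
  hH.map_gram

lemma map_mmseSINR (hH : IsInvariantPolynomialEnsemble P H p q) (δ : ℝ) (k : Fin nt) :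
    P.map (fun ω => mmseSINR δ (H ω) k) = ((unitaryHaar nt).prod (polynomialEnsembleLaw q)).map
      fun Ul => gramSINR δ (unitaryConjDiagonal Ul.1 Ul.2) k := by
  have hgram : (P.map fun ω => (H ω)ᴴ * H ω).map (fun G => gramSINR δ G k) =
      P.map fun ω => mmseSINR δ (H ω) k :=
    AEMeasurable.map_map_of_aemeasurable (measurable_gramSINR δ k).aemeasurable
      hH.aemeasurable_gram
  rw [← hgram, hH.map_gram_eq]
  exact Measure.map_map (measurable_gramSINR δ k) continuous_unitaryConjDiagonal.measurable

lemma ae_map_mmseSINR_pos (hH : IsInvariantPolynomialEnsemble P H p q) (hδ : 0 < δ) (k : Fin nt) :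
    ∀ᵐ g ∂P.map (fun ω => mmseSINR δ (H ω) k), 0 < g := by
  rw [hH.map_mmseSINR, ae_map_iff (measurable_gramSINR_unitaryConjDiagonal δ k).aemeasurable
    measurableSet_Ioi]
  filter_upwards [Measure.quasiMeasurePreserving_snd.ae (ae_polynomialEnsembleLaw_pos (q := q))]
    with Ul hl using gramSINR_unitaryConjDiagonal_pos (fun a => mul_pos hδ (hl a)) Ul.1 k

variable [IsProbabilityMeasure P]

lemma isProbabilityMeasure_polynomialEnsembleLaw (hH : IsInvariantPolynomialEnsemble P H p q) :
    IsProbabilityMeasure (polynomialEnsembleLaw q) := by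
  have hmass := (Measure.isProbabilityMeasure_map hH.aemeasurable_gram).measure_univ
  rw [hH.map_gram_eq, Measure.map_apply continuous_unitaryConjDiagonal.measurable
    MeasurableSet.univ, preimage_univ, ← univ_prod_univ, Measure.prod_prod, measure_univ,
    one_mul] at hmass
  exact ⟨hmass⟩

theorem integral_inv_pow_map_mmseSINR (hH : IsInvariantPolynomialEnsemble P H p q) (hδ : 0 < δ)
    (k : Fin nt) {s : ℝ} (hs : |s| < 1 / 2) :
    ∫ g, ((1 + s * (1 + g)⁻¹) ^ nt)⁻¹ ∂P.map (fun ω => mmseSINR δ (H ω) k) =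
      ∫ y in Ioi (0 : ℝ),
        polynomialEnsembleKernel p q (-1 / δ) y * (1 + s * (1 + δ * y)⁻¹)⁻¹ := by
  have := hH.isProbabilityMeasure_polynomialEnsembleLaw
  have hs1 : -1 < s := by linarith [(abs_lt.1 hs).1]
  have hSINR := measurable_gramSINR_unitaryConjDiagonal (n := nt) δ k
  have hmeas : Measurable fun g : ℝ => ((1 + s * (1 + g)⁻¹) ^ nt)⁻¹ := by fun_prop
  have hint : Integrable (fun Ul : Matrix.unitaryGroup (Fin nt) ℂ × (Fin nt → ℝ) =>
      ((1 + s * (1 + gramSINR δ (unitaryConjDiagonal Ul.1 Ul.2) k)⁻¹) ^ nt)⁻¹)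
      ((unitaryHaar nt).prod (polynomialEnsembleLaw q)) := by
    refine .of_bound (hmeas.comp hSINR).aestronglyMeasurable (2 ^ nt) ?_
    filter_upwards [Measure.quasiMeasurePreserving_snd.ae (ae_polynomialEnsembleLaw_pos (q := q))]
      with Ul hl using norm_inv_one_add_mul_inv_pow_le hs
        (gramSINR_unitaryConjDiagonal_pos (fun a => mul_pos hδ (hl a)) Ul.1 k) nt
  rw [← hH.system.integral_prod_inv_polynomialEnsembleLaw k.pos hH.density_nonneg hδ hs1,
    hH.map_mmseSINR, integral_map hSINR.aemeasurable hmeas.aestronglyMeasurable,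
    integral_prod_symm _ hint]
  refine integral_congr_ae ?_
  filter_upwards [ae_polynomialEnsembleLaw_pos (q := q)] with l hl
    using integral_gramSINR_unitaryConjDiagonal (fun a => mul_pos hδ (hl a)) k hs1

theorem ae_nonneg_and_map_mmseSINR_eq_withDensity (hH : IsInvariantPolynomialEnsemble P H p q)
    (hnt : 2 ≤ nt) (hδ : 0 < δ) (k : Fin nt) :
    (∀ᵐ g ∂(volume.restrict (Ioi (0 : ℝ))),
      0 ≤ sinrDensity nt δ (polynomialEnsembleKernel p q (-1 / δ)) g) ∧
    P.map (fun ω => mmseSINR δ (H ω) k) = (volume.restrict (Ioi (0 : ℝ))).withDensity fun g =>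
      ENNReal.ofReal (sinrDensity nt δ (polynomialEnsembleKernel p q (-1 / δ)) g) := by
  have hK := hH.system.integrableOn_polynomialEnsembleKernel (-1 / δ)
  have := Measure.isProbabilityMeasure_map (hH.aemeasurable_mmseSINR δ k)
  have hpos : ∀ᵐ g ∂(volume.restrict (Ioi (0 : ℝ))), 0 < g := ae_restrict_mem measurableSet_Ioi
  refine ae_nonneg_and_eq_withDensity_of_integral_inv_one_add_mul_inv_pow_eq
    (hH.ae_map_mmseSINR_pos hδ k) hpos
    (integrableOn_sinrDensity hnt hδ hK) k.pos.ne' ?_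
  filter_upwards [Metric.ball_mem_nhds (0 : ℝ) one_half_pos] with s hs
  rw [mem_ball_zero_iff, Real.norm_eq_abs] at hs
  have hs1 : -1 < s := by linarith [(abs_lt.1 hs).1]
  rw [hH.integral_inv_pow_map_mmseSINR hδ k hs,
    ← integral_sinrDensity_mul_inv_one_add_mul_inv_pow hnt hδ hK hs1
      (hH.system.integrableOn_polynomialEnsembleKernel_mul_inv hδ hs1)]
  simp only [mul_comm]

lemma integrable_log_one_add_mmseSINR (hH : IsInvariantPolynomialEnsemble P H p q) (hnt : 2 ≤ nt)
    (hδ : 0 < δ) (k : Fin nt) : Integrable (fun ω => Real.log (1 + mmseSINR δ (H ω) k)) P := by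
  have hK := hH.system.integrableOn_polynomialEnsembleKernel (-1 / δ)
  have hKlog := hH.system.integrableOn_log_mul_polynomialEnsembleKernel hnt hδ.le (-1 / δ)
  have hlog : Measurable fun g : ℝ => Real.log (1 + g) := by fun_prop
  refine (integrable_map_measure hlog.aestronglyMeasurable (hH.aemeasurable_mmseSINR δ k)).1 ?_
  rw [(hH.ae_nonneg_and_map_mmseSINR_eq_withDensity hnt hδ k).2]
  refine integrable_withDensity_ofReal (integrableOn_sinrDensity hnt hδ hK).aemeasurable hlog ?_
  refine (integrableOn_sinrDensity_mul hnt hδ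
    (integrable_prod_mul_sinrMixingKernel_mul_log hnt hδ hK hKlog)).congr ?_
  exact ae_of_all _ fun g => mul_comm _ _

theorem integral_log_one_add_mmseSINR (hH : IsInvariantPolynomialEnsemble P H p q) (hnt : 2 ≤ nt)
    (hδ : 0 < δ) (k : Fin nt) :
    ∫ ω, Real.log (1 + mmseSINR δ (H ω) k) ∂P =
      (∫ x in Ioi (0 : ℝ), Real.log (1 + δ * x) * polynomialEnsembleKernel p q (-1 / δ) x) +
        harmonic (nt - 1) := by
  have hK := hH.system.integrableOn_polynomialEnsembleKernel (-1 / δ)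
  have hKlog := hH.system.integrableOn_log_mul_polynomialEnsembleKernel hnt hδ.le (-1 / δ)
  have hlog : Measurable fun g : ℝ => Real.log (1 + g) := by fun_prop
  obtain ⟨hnonneg, hlaw⟩ := hH.ae_nonneg_and_map_mmseSINR_eq_withDensity hnt hδ k
  rw [← integral_map (hH.aemeasurable_mmseSINR δ k) hlog.aestronglyMeasurable, hlaw,
    integral_withDensity_ofReal (integrableOn_sinrDensity hnt hδ hK).aemeasurable hnonneg,
    integral_sinrDensity_mul_log hnt hδ hK hKlog,
    hH.system.integral_polynomialEnsembleKernel k.pos, one_mul]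

theorem mmseSumRate_eq (hH : IsInvariantPolynomialEnsemble P H p q) (hnt : 2 ≤ nt) (hδ : 0 < δ) :
    mmseSumRate P δ H =
      nt * ((∫ x in Ioi (0 : ℝ), Real.log (1 + δ * x) * polynomialEnsembleKernel p q (-1 / δ) x) +
        Real.eulerMascheroniConstant + logDeriv Real.Gamma nt) := by
  simp only [mmseSumRate, hH.integral_log_one_add_mmseSINR hnt hδ, Finset.sum_const,
    Finset.card_univ, Fintype.card_fin, nsmul_eq_mul,
    logDeriv_Gamma_natCast (zero_lt_two.trans_le hnt)]
  ring

end IsInvariantPolynomialEnsemble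

theorem proposition2 {Ω : Type*} [MeasurableSpace Ω] (P : Measure Ω) [IsProbabilityMeasure P]
    (nr nt : ℕ) (hnt : 2 ≤ nt) (hnr : nt ≤ nr) (δ : ℝ) (hδ : 0 < δ)
    (H : Ω → Matrix (Fin nr) (Fin nt) ℂ)
    (p : Fin nt → Polynomial ℝ) (q : Fin nt → ℝ → ℝ)
    (hH : IsInvariantPolynomialEnsemble P H p q)
    (K : ℝ → ℝ → ℝ) (hK : K = polynomialEnsembleKernel p q)
    (ρ : ℝ → ℝ)
    (hρ : ρ = fun g => ((nt : ℝ) - 1) / δ * (g / (g + 1)) ^ nt *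
      ∫ x in (0 : ℝ)..1, (1 - x) ^ (nt - 2) * (x + 1 / g) * K (-1 / δ) (g / δ * x)) :
    -- the integral in the density converges absolutely for every positive argument
    (∀ g : ℝ, 0 < g → IntervalIntegrable
      (fun x => (1 - x) ^ (nt - 2) * (x + 1 / g) * K (-1 / δ) (g / δ * x)) volume 0 1) ∧
    -- `ρ` is the probability density on `(0, ∞)` of the SINR of every stream
    IntegrableOn ρ (Set.Ioi 0) ∧
    (∀ᵐ g ∂(volume.restrict (Set.Ioi (0 : ℝ))), 0 ≤ ρ g) ∧
    (∀ k : Fin nt, AEMeasurable (fun ω => mmseSINR δ (H ω) k) P ∧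
      P.map (fun ω => mmseSINR δ (H ω) k) =
        (volume.restrict (Set.Ioi (0 : ℝ))).withDensity fun g => ENNReal.ofReal (ρ g)) ∧
    -- the sum rate, with all expectations and integrals absolutely convergent
    (∀ k : Fin nt, Integrable (fun ω => Real.log (1 + mmseSINR δ (H ω) k)) P) ∧
    IntegrableOn (fun x => Real.log (1 + δ * x) * K (-1 / δ) x) (Set.Ioi 0) ∧
    mmseSumRate P δ H =
      nt * ((∫ x in Set.Ioi (0 : ℝ), Real.log (1 + δ * x) * K (-1 / δ) x) +
        Real.eulerMascheroniConstant + logDeriv Real.Gamma nt) := by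
  subst hK hρ
  have hK := hH.system.integrableOn_polynomialEnsembleKernel (-1 / δ)
  exact ⟨fun g hg => intervalIntegrable_mul_comp_mul (div_pos hg hδ) hK (by fun_prop),
    integrableOn_sinrDensity hnt hδ hK,
    (hH.ae_nonneg_and_map_mmseSINR_eq_withDensity hnt hδ ⟨0, zero_lt_two.trans_le hnt⟩).1,
    fun k => ⟨hH.aemeasurable_mmseSINR δ k,
      (hH.ae_nonneg_and_map_mmseSINR_eq_withDensity hnt hδ k).2⟩,
    hH.integrable_log_one_add_mmseSINR hnt hδ,
    hH.system.integrableOn_log_mul_polynomialEnsembleKernel hnt hδ.le (-1 / δ),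
    hH.mmseSumRate_eq hnt hδ⟩
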